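/- A rational (resp. lattice) polytope in $\mathbb{R}^n$ is a polytope whose vertices all lie in $\mathbb{Q}^n$ (resp. $\mathbb{Z}^n$). For a rational polytope $P\subset\mathbb{R}^n$ let $\mathrm{Ehr}_P(t)=1+\sum_{k\ge 1}|kP\cap\mathbb{Z}^n|\,t^k$, let $\operatorname{den}P$ be the smallest positive integer $m$ such that $mP$ is a lattice polytope, and let $\delta_P$ be the $\delta$-polynomial of $P$, i.e. the unique polynomial with $\mathrm{Ehr}_P(t)=\delta_P(t)/(1-t^{\operatorname{den}P})^{\dim P+1}$ (it exists by Ehrhart's theorem). For convex sets $J,K\subset\mathbb{R}^n$ write $J\oplus K=\operatorname{conv}(J\cup K)$. One says that $J\oplus K$ is a free sum if, after applying some element of $\mathsf{SL}_n(\mathbb{Z})$ simultaneously to $J$ and $K$, both sets contain the origin and their linear spans are orthogonal coordinate subspaces (subspaces spanned by disjoint sets of standard basis vectors). For a polytope $P$ containing the origin, with linear span $\operatorname{lin}P$, let $P^\vee=\{\varphi\in(\operatorname{lin}P)^*:\varphi(a)\le 1\text{ for all }a\in P\}$; it is called a lattice polyhedron if each of its vertices takes integer values on $\operatorname{lin}P\cap\mathbb{Z}^n$.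 Theorem. Let $P,Q\subset\mathbb{R}^n$ be rational polytopes such that $P^\vee$ is a lattice polyhedron and $P\oplus Q$ is a free sum. Then $$\mathrm{Ehr}_{P\oplus Q}(t)=(1-t)\,\mathrm{Ehr}_P(t)\,\mathrm{Ehr}_Q(t),$$ and hence $$\delta_{P\oplus Q}(t)=\frac{(1-t)\,\bigl(1-t^{\operatorname{lcm}(\operatorname{den}P,\operatorname{den}Q)}\bigr)^{\dim P+\dim Q+1}}{(1-t^{\operatorname{den}P})^{\dim P+1}\,(1-t^{\operatorname{den}Q})^{\dim Q+1}}\;\delta_P(t)\,\delta_Q(t).$$ In particular, if $P$ and $Q$ are moreover lattice polytopes, then $\delta_{P\oplus Q}=\delta_P\,\delta_Q$. -/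

import Mathlib

open scoped Pointwise

noncomputable section

namespace FreeSumEhrhart

/-- The integer lattice `ℤⁿ` inside `ℝⁿ`. -/
def integerPoints (n : ℕ) : Set (Fin n → ℝ) :=
  {x | ∀ i, ∃ z : ℤ, x i = z}

/-- The rational points `ℚⁿ` inside `ℝⁿ`. -/
def rationalPoints (n : ℕ) : Set (Fin n → ℝ) :=
  {x | ∀ i, ∃ q : ℚ, x i = q}

/-- A polytope is the convex hull of a finite set of points. -/
def IsPolytope {n : ℕ} (P : Set (Fin n → ℝ)) : Prop :=
  ∃ V : Set (Fin n → ℝ), V.Finite ∧ P = convexHull ℝ V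

/-- A rational polytope: all vertices (extreme points) lie in `ℚⁿ`. -/
def IsRationalPolytope {n : ℕ} (P : Set (Fin n → ℝ)) : Prop :=
  IsPolytope P ∧ P.extremePoints ℝ ⊆ rationalPoints n

/-- A lattice polytope: all vertices (extreme points) lie in `ℤⁿ`. -/
def IsLatticePolytope {n : ℕ} (P : Set (Fin n → ℝ)) : Prop :=
  IsPolytope P ∧ P.extremePoints ℝ ⊆ integerPoints n

/-- The denominator of a rational polytope: the smallest positive integer `m` such that the
dilate `mP` is a lattice polytope. -/
def den {n : ℕ} (P : Set (Fin n → ℝ)) : ℕ :=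
  sInf {m : ℕ | 0 < m ∧ IsLatticePolytope ((m : ℝ) • P)}

/-- The dimension of a (nonempty) polytope, i.e. that of its affine hull. -/
def dim {n : ℕ} (P : Set (Fin n → ℝ)) : ℕ :=
  Module.finrank ℝ (vectorSpan ℝ P)

/-- The Ehrhart series `1 + ∑_{k ≥ 1} #(kP ∩ ℤⁿ) t^k`. -/
def ehrhartSeries {n : ℕ} (P : Set (Fin n → ℝ)) : PowerSeries ℚ :=
  PowerSeries.mk fun k =>
    if k = 0 then 1 else ((((k : ℝ) • P) ∩ integerPoints n).ncard : ℚ)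

/-- `δ` is the `δ`-polynomial (`h^*`-polynomial) of `P`:
`Ehr_P(t) = δ(t) / (1 - t^{den P})^{dim P + 1}`, written without the (invertible) denominator. -/
def IsDeltaPolynomial {n : ℕ} (P : Set (Fin n → ℝ)) (δ : Polynomial ℚ) : Prop :=
  (1 - PowerSeries.X ^ den P) ^ (dim P + 1) * ehrhartSeries P = (δ : PowerSeries ℚ)

/-- A set has at most one `δ`-polynomial. -/
theorem IsDeltaPolynomial.unique {n : ℕ} {P : Set (Fin n → ℝ)} {δ δ' : Polynomial ℚ}
    (h : IsDeltaPolynomial P δ) (h' : IsDeltaPolynomial P δ') : δ = δ' :=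
  Polynomial.coe_injective ℚ (h.symm.trans h')

/-- The polar dual of `P`, taken in the dual space of the linear span of `P`. -/
def polarDual {n : ℕ} (P : Set (Fin n → ℝ)) :
    Set (Module.Dual ℝ (Submodule.span ℝ P)) :=
  {φ | ∀ a : Submodule.span ℝ P, (a : Fin n → ℝ) ∈ P → φ a ≤ 1}

/-- The dual integer lattice of `lin P`: the functionals on `lin P` with integer values at the
integer points of `lin P`. -/
def dualIntegerLattice {n : ℕ} (P : Set (Fin n → ℝ)) :
    Set (Module.Dual ℝ (Submodule.span ℝ P)) :=
  {φ | ∀ a : Submodule.span ℝ P, (a : Fin n → ℝ) ∈ integerPoints n → ∃ z : ℤ, φ a = z}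

/-- The polar dual of `P` is a lattice polyhedron: its vertices (extreme points) lie in the
dual integer lattice. -/
def DualIsLatticePolyhedron {n : ℕ} (P : Set (Fin n → ℝ)) : Prop :=
  (polarDual P).extremePoints ℝ ⊆ dualIntegerLattice P

/-- `J ⊕ K = conv (J ∪ K)`. -/
def hullSum {n : ℕ} (J K : Set (Fin n → ℝ)) : Set (Fin n → ℝ) :=
  convexHull ℝ (J ∪ K)

/-- The coordinate subspace of `ℝⁿ` spanned by the standard basis vectors `e_i`, `i ∈ A`. -/
def coordSubspace {n : ℕ} (A : Set (Fin n)) : Submodule ℝ (Fin n → ℝ) :=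
  Submodule.span ℝ ((fun i => (Pi.single i 1 : Fin n → ℝ)) '' A)

/-- `J` and `K` contain the origin and their linear spans are orthogonal coordinate subspaces
(coordinate subspaces are orthogonal exactly when their index sets are disjoint). -/
def IsCoordinateFreeSum {n : ℕ} (J K : Set (Fin n → ℝ)) : Prop :=
  0 ∈ J ∧ 0 ∈ K ∧ ∃ A B : Set (Fin n), Disjoint A B ∧
    Submodule.span ℝ J = coordSubspace A ∧ Submodule.span ℝ K = coordSubspace B

/-- The action of an integer matrix of determinant one on `ℝⁿ`. -/
def slAct {n : ℕ} (g : Matrix.SpecialLinearGroup (Fin n) ℤ) (x : Fin n → ℝ) : Fin n → ℝ :=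
  Matrix.mulVec ((g : Matrix (Fin n) (Fin n) ℤ).map (fun z : ℤ => (z : ℝ))) x

/-- `J ⊕ K` is a free sum, up to the action of `SL_n(ℤ)`. -/
def IsFreeSum {n : ℕ} (J K : Set (Fin n → ℝ)) : Prop :=
  ∃ g : Matrix.SpecialLinearGroup (Fin n) ℤ, IsCoordinateFreeSum (slAct g '' J) (slAct g '' K)

end FreeSumEhrhart

end

/-!
The identity of Ehrhart series rests on one fact about `P`: the gauge
`x ↦ min {r ≥ 0 | x ∈ r • P}` takes integer values at lattice points
(`mem_floor_smul_of_dualIsLatticePolyhedron`). Indeed the gauge at `x` is the supremum of `φ x` over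
the polar dual; the polar dual is a polyhedron without lines, so the supremum is attained at a
vertex (`exists_extremePoint_ge`), which is integral by hypothesis. A free sum comes with a linear
projection that preserves the lattice, fixes `P` and kills `Q` (`IsFreeSum.exists_splitting`). Hence
a lattice point of `k(P ⊕ Q)` is uniquely `x + y` with `x` a lattice point of integral gauge `i ≤ k`
and `y` a lattice point of `(k - i)Q`, and the lattice points of gauge `i` are counted by the
coefficients of `(1 - t) Ehr_P` (`ehrhartSeries_hullSum`).

The `δ`-polynomials exist by Ehrhart's theorem (`hasDenominator_ehrhartSeries`), obtained here
without triangulations. The lattice points of the cone over a polytope with vertices `v₁, …, v_M`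
are finitely generated under translation by the vectors `(p v_i, p)`, where `p` is a common
denominator; choosing lexicographically minimal representations turns their generating function
into a finite sum of generating functions of lower sets of exponents, and Dickson's lemma gives the
denominator `(1 - t^p)^M`. As the number of lattice points of `kP` grows at most like `k ^ dim P`,
the exponent `M` can be lowered to `dim P + 1` (`HasDenominator.of_growth`).

The formula for the `δ`-polynomials follows because the dimension of a free sum is the sum of the
dimensions and its denominator is the least common multiple of the denominators; the latter holds
since every nonzero vertex of `P` or `Q` is a vertex of `P ⊕ Q`.
-/

open scoped Pointwise

noncomputable section

namespace FreeSumEhrhart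

/-! ### Rational generating functions with poles at roots of unity -/

/-- `F` is a rational function whose denominator divides `(1 - t^p)^M`. -/
def HasDenominator (p M : ℕ) (F : PowerSeries ℚ) : Prop :=
  ∃ δ : Polynomial ℚ, (1 - PowerSeries.X ^ p) ^ M * F = (δ : PowerSeries ℚ)

lemma HasDenominator.add {p M : ℕ} {F G : PowerSeries ℚ} (hF : HasDenominator p M F)
    (hG : HasDenominator p M G) : HasDenominator p M (F + G) := by
  obtain ⟨f, hf⟩ := hF
  obtain ⟨g, hg⟩ := hG
  exact ⟨f + g, by rw [mul_add, hf, hg, Polynomial.coe_add]⟩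

lemma HasDenominator.X_pow_mul {p M : ℕ} {F : PowerSeries ℚ} (hF : HasDenominator p M F)
    (c : ℕ) : HasDenominator p M (PowerSeries.X ^ c * F) := by
  obtain ⟨f, hf⟩ := hF
  refine ⟨Polynomial.X ^ c * f, ?_⟩
  rw [Polynomial.coe_mul, Polynomial.coe_pow, Polynomial.coe_X, ← hf]
  ring

lemma HasDenominator.mono {p M N : ℕ} {F : PowerSeries ℚ} (hF : HasDenominator p M F)
    (h : M ≤ N) : HasDenominator p N F := by
  obtain ⟨f, hf⟩ := hF
  obtain ⟨c, rfl⟩ := Nat.exists_eq_add_of_le h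
  refine ⟨(1 - Polynomial.X ^ p) ^ c * f, ?_⟩
  rw [Polynomial.coe_mul, Polynomial.coe_pow, Polynomial.coe_sub, Polynomial.coe_pow,
    Polynomial.coe_X, Polynomial.coe_one, ← hf]
  ring

/-- The generating function `∑_{x ∈ S} t^{h x}` of a set graded by `h`; a coefficient is
meaningful only if the corresponding level of `S` is finite. -/
def countSeries {α : Type*} (S : Set α) (h : α → ℕ) : PowerSeries ℚ :=
  PowerSeries.mk fun k => (({x | x ∈ S ∧ h x = k}).ncard : ℚ)

lemma countSeries_union {α : Type*} {S T : Set α} {h : α → ℕ} (hd : Disjoint S T)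
    (hS : ∀ k, {x | x ∈ S ∧ h x = k}.Finite) (hT : ∀ k, {x | x ∈ T ∧ h x = k}.Finite) :
    countSeries (S ∪ T) h = countSeries S h + countSeries T h := by
  ext k
  simp only [countSeries, PowerSeries.coeff_mk, map_add]
  have : {x | x ∈ S ∪ T ∧ h x = k} = {x | x ∈ S ∧ h x = k} ∪ {x | x ∈ T ∧ h x = k} := by
    ext x; simp only [Set.mem_union, Set.mem_ofPred_eq]; tauto
  rw [this, Set.ncard_union_eq _ (hS k) (hT k), Nat.cast_add]
  exact Set.disjoint_left.2 fun x hx hy => Set.disjoint_left.1 hd hx.1 hy.1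

lemma countSeries_image {α β : Type*} {S : Set α} {h : α → ℕ} {h' : β → ℕ} {f : α → β} {c : ℕ}
    (hf : Set.InjOn f S) (hc : ∀ x ∈ S, h' (f x) = c + h x) :
    countSeries (f '' S) h' = PowerSeries.X ^ c * countSeries S h := by
  ext k
  rw [PowerSeries.coeff_X_pow_mul']
  simp only [countSeries, PowerSeries.coeff_mk]
  split_ifs with hk
  · have : {x | x ∈ f '' S ∧ h' x = k} = f '' {x | x ∈ S ∧ h x = k - c} := by
      ext y
      constructor
      · rintro ⟨⟨x, hx, rfl⟩, hy⟩
        exact ⟨x, ⟨hx, by have := hc x hx; omega⟩, rfl⟩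
      · rintro ⟨x, ⟨hx, hy⟩, rfl⟩
        exact ⟨⟨x, hx, rfl⟩, by have := hc x hx; omega⟩
    rw [this, (hf.mono fun x hx => hx.1).ncard_image]
  · have : {x | x ∈ f '' S ∧ h' x = k} = ∅ := by
      rw [Set.eq_empty_iff_forall_notMem]
      rintro y ⟨⟨x, hx, rfl⟩, hy⟩
      have := hc x hx
      omega
    rw [this, Set.ncard_empty, Nat.cast_zero]

/-! ### Hilbert series of finitely generated graded sets -/

lemma wellFoundedLT_lowerSet {α : Type*} [Preorder α] [WellQuasiOrderedLE α] :
    WellFoundedLT (LowerSet α) := by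
  refine ⟨wellFounded_iff_isEmpty_descending_chain.2 ⟨fun ⟨L, hL⟩ => ?_⟩⟩
  have hanti : StrictAnti L := strictAnti_nat_of_succ_lt hL
  have hex : ∀ n, ∃ x, x ∈ L n ∧ x ∉ L (n + 1) := fun n => by
    exact Set.not_subset.1 (LowerSet.coe_subset_coe.not.2 (hL n).not_ge)
  choose x hx hx' using hex
  obtain ⟨m, k, hmk, hle⟩ := wellQuasiOrdered_le x
  exact hx' m ((L (m + 1)).lower hle (hanti.antitone (Nat.succ_le_of_lt hmk) (hx k)))

lemma finite_degree_level {σ : Type*} [Finite σ] {p : ℕ} (hp : 0 < p) (S : Set (σ →₀ ℕ)) (k : ℕ) :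
    {x | x ∈ S ∧ p * x.degree = k}.Finite := by
  classical
  have := Fintype.ofFinite σ
  refine ((Set.finite_Iic (fun _ : σ => k)).preimage
    (f := fun n : σ →₀ ℕ => (n : σ → ℕ)) DFunLike.coe_injective.injOn).subset ?_
  rintro x ⟨-, hx⟩ i
  have h1 := Finsupp.le_degree i x
  have h2 : x.degree ≤ p * x.degree := Nat.le_mul_of_pos_left _ hp
  dsimp only
  omega

/-- The Hilbert series of a monomial quotient: a lower set `L` of exponents supported on `J` has
a generating function with denominator `(1 - t^p)^{|J|}`. Translation by `e_i` maps
the lower set `L - e_i ⊆ L` into `L`, with complement `{n ∈ L | n i = 0}`; either this settles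
the claim (`L - e_i = L`) or one recurses, which stops by Dickson's lemma. -/
lemma hasDenominator_lowerSet {σ : Type*} [Finite σ] {p : ℕ} (hp : 0 < p) (J : Finset σ) :
    ∀ L : LowerSet (σ →₀ ℕ), (∀ n ∈ L, ∀ i ∉ J, n i = 0) →
      HasDenominator p J.card (countSeries (L : Set (σ →₀ ℕ)) fun n => p * n.degree) := by
  classical
  induction J using Finset.induction_on with
  | empty =>
    intro L hL
    have h0 : ∀ n ∈ L, n = 0 := fun n hn => Finsupp.ext fun i => hL n hn i (Finset.notMem_empty i)
    refine ⟨Polynomial.C ((L : Set (σ →₀ ℕ)).ncard : ℚ), ?_⟩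
    rw [Finset.card_empty, pow_zero, one_mul]
    ext k
    simp only [countSeries, PowerSeries.coeff_mk, Polynomial.coe_C, PowerSeries.coeff_C]
    split_ifs with hk
    · congr 2
      ext n
      simp only [Set.mem_ofPred_eq, SetLike.mem_coe, and_iff_left_iff_imp]
      intro hn
      rw [h0 n hn, hk]
      simp
    · have : {x | x ∈ (L : Set (σ →₀ ℕ)) ∧ p * x.degree = k} = ∅ := by
        rw [Set.eq_empty_iff_forall_notMem]
        rintro n ⟨hn, rfl⟩
        rw [h0 n hn] at hk
        simp at hk
      rw [this, Set.ncard_empty, Nat.cast_zero]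
  | insert i J hi ih =>
    have hwf : WellFoundedLT (LowerSet (σ →₀ ℕ)) := wellFoundedLT_lowerSet
    intro L
    induction L using hwf.induction with
    | ind L ihL =>
      intro hL
      set e : σ →₀ ℕ := Finsupp.single i 1 with he
      let L₀ : LowerSet (σ →₀ ℕ) := ⟨{n | n ∈ L ∧ n i = 0}, fun a b hba ha =>
        ⟨L.lower hba ha.1, Nat.le_zero.1 ((hba i).trans ha.2.le)⟩⟩
      let L₁ : LowerSet (σ →₀ ℕ) := ⟨{n | e + n ∈ L}, fun a b hba ha =>
        L.lower (add_le_add_right hba e) ha⟩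
      have hL₁ : L₁ ≤ L := fun n hn => L.lower le_add_self hn
      have hsplit : countSeries (L : Set (σ →₀ ℕ)) (fun n => p * n.degree)
          = countSeries (L₀ : Set (σ →₀ ℕ)) (fun n => p * n.degree)
            + PowerSeries.X ^ p * countSeries (L₁ : Set (σ →₀ ℕ)) (fun n => p * n.degree) := by
        rw [← countSeries_image (f := fun n => e + n) (h' := fun n => p * n.degree)
          (fun a _ b _ hab => add_left_cancel hab)
          (fun n _ => by simp [he, mul_add]), ← countSeries_union _
          (finite_degree_level hp _) (finite_degree_level hp _)]
        · congr 1
          ext n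
          constructor
          · intro hn
            by_cases h0 : n i = 0
            · exact Or.inl ⟨hn, h0⟩
            · have hen : e + (n - e) = n := by
                apply add_tsub_cancel_of_le
                rw [he, Finsupp.single_le_iff]
                omega
              refine Or.inr ⟨n - e, ?_, hen⟩
              change e + (n - e) ∈ L
              rwa [hen]
          · rintro (hn | ⟨m, hm, rfl⟩)
            · exact hn.1
            · exact hm
        · rw [Set.disjoint_left]
          rintro _ ⟨-, h0⟩ ⟨m, -, rfl⟩
          simp [he] at h0
      have h₀ := ih L₀ fun n hn j hj => by
        by_cases hji : j = i
        · rw [hji]; exact hn.2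
        · exact hL n hn.1 j (by simp [hj, hji])
      rw [Finset.card_insert_of_notMem hi]
      rcases hL₁.eq_or_lt with heq | hlt
      · obtain ⟨f, hf⟩ := h₀
        refine ⟨f, ?_⟩
        rw [heq] at hsplit
        rw [← hf, pow_succ, mul_assoc, sub_mul, one_mul]
        nth_rewrite 1 [hsplit]
        rw [add_sub_cancel_right]
      · rw [hsplit]
        refine (h₀.mono (Nat.le_succ _)).add (HasDenominator.X_pow_mul ?_ p)
        have := ihL L₁ hlt fun n hn => hL n (hL₁ hn)
        rwa [Finset.card_insert_of_notMem hi] at this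

/-- The Hilbert series of a finitely generated module over a monoid algebra, in combinatorial
form: the set of all `b + ∑ n_i w_i` with `b ∈ B`, where all generators `w_i` have degree `p`,
has a generating function with denominator `(1 - t^p)^M`. Keeping for each element only its
representation that is minimal for the lexicographic order leaves lower sets of exponents. -/
lemma hasDenominator_finitely_generated {G : Type*} [AddCommMonoid G] {M p : ℕ} (hp : 0 < p)
    (ht : G →+ ℕ) (w : Fin M → G) (hw : ∀ i, ht (w i) = p) (B : Finset G) :
    HasDenominator p M (countSeries
      {x | ∃ b ∈ B, ∃ n : Fin M →₀ ℕ, x = b + Finsupp.linearCombination ℕ w n} ht) := by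
  classical
  set N : (Fin M →₀ ℕ) →ₗ[ℕ] G := Finsupp.linearCombination ℕ w with hN
  have hht : ∀ n, ht (N n) = p * n.degree := fun n => by
    rw [hN, Finsupp.linearCombination_apply, Finsupp.sum, map_sum]
    simp [hw, Finsupp.degree_apply, Finset.sum_mul, mul_comm p]
  have hfin : ∀ (B : Finset G) k,
      {x | x ∈ {x | ∃ b ∈ B, ∃ n, x = b + N n} ∧ ht x = k}.Finite := by
    intro B k
    refine ((B.finite_toSet).biUnion fun b _ =>
      ((finite_degree_level hp Set.univ (k - ht b)).image fun n => b + N n)).subset ?_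
    rintro x ⟨⟨b, hb, n, rfl⟩, hx⟩
    simp only [Set.mem_iUnion]
    refine ⟨b, hb, n, ⟨trivial, ?_⟩, rfl⟩
    rw [map_add, hht] at hx
    omega
  induction B using Finset.induction_on with
  | empty =>
    refine ⟨0, ?_⟩
    have : countSeries {x | ∃ b ∈ (∅ : Finset G), ∃ n, x = b + N n} ht = 0 := by
      ext k
      simp [countSeries]
    rw [this, mul_zero, Polynomial.coe_zero]
  | insert b B hb ih =>
    set S : Set G := {x | ∃ b ∈ B, ∃ n, x = b + N n} with hS
    let m : MonomialOrder (Fin M) := MonomialOrder.lex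
    let R : LowerSet (Fin M →₀ ℕ) :=
      ⟨{n | b + N n ∉ S ∧ ∀ n', m.toSyn n' < m.toSyn n → b + N n' ≠ b + N n}, by
        rintro a c hca ⟨ha, ha'⟩
        obtain ⟨l, rfl⟩ := exists_add_of_le hca
        refine ⟨?_, fun n' hn' h => ha' (n' + l) ?_ ?_⟩
        · rintro ⟨b', hb', n, hn⟩
          exact ha ⟨b', hb', n + l, by rw [map_add, ← add_assoc, hn, map_add, add_assoc]⟩
        · rw [map_add, map_add]
          exact add_lt_add_left hn' _
        · rw [map_add, ← add_assoc, h, map_add, add_assoc]⟩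
    have hunion : {x | ∃ b' ∈ insert b B, ∃ n, x = b' + N n}
        = S ∪ (fun n => b + N n) '' (R : Set (Fin M →₀ ℕ)) := by
      ext x
      constructor
      · rintro ⟨b', hb', n, rfl⟩
        rcases Finset.mem_insert.1 hb' with rfl | hb'
        · by_cases hx : b' + N n ∈ S
          · exact Or.inl hx
          · right
            have hne : {s : m.syn | b' + N (m.toSyn.symm s) = b' + N n}.Nonempty :=
              ⟨m.toSyn n, by simp⟩
            set s := wellFounded_lt.min _ hne with hs
            have hmem : b' + N (m.toSyn.symm s) = b' + N n := wellFounded_lt.min_mem _ hne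
            refine ⟨m.toSyn.symm s, ⟨by rwa [hmem], fun n' hn' h => ?_⟩, hmem⟩
            rw [AddEquiv.apply_symm_apply] at hn'
            refine wellFounded_lt.not_lt_min {s : m.syn | b' + N (m.toSyn.symm s) = b' + N n}
              (x := m.toSyn n') ?_ hn'
            simp only [Set.mem_ofPred_eq, AddEquiv.symm_apply_apply]
            rw [h, hmem]
        · exact Or.inl ⟨b', hb', n, rfl⟩
      · rintro (⟨b', hb', n, rfl⟩ | ⟨n, -, rfl⟩)
        · exact ⟨b', Finset.mem_insert_of_mem hb', n, rfl⟩
        · exact ⟨b, Finset.mem_insert_self _ _, n, rfl⟩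
    have himg : (fun n => b + N n) '' (R : Set (Fin M →₀ ℕ)) ⊆
        {x | ∃ b' ∈ insert b B, ∃ n, x = b' + N n} := by
      rintro _ ⟨n, -, rfl⟩
      exact ⟨b, Finset.mem_insert_self _ _, n, rfl⟩
    rw [hunion, countSeries_union]
    · refine ih.add ?_
      rw [countSeries_image (h := fun n => p * n.degree) (c := ht b)]
      · refine HasDenominator.X_pow_mul ?_ _
        have := hasDenominator_lowerSet hp (Finset.univ : Finset (Fin M)) R
          fun n _ i hi => absurd (Finset.mem_univ i) hi
        rwa [Finset.card_univ, Fintype.card_fin] at this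
      · intro n hn n' hn' h
        have h1 := fun hlt => hn.2 n' hlt h.symm
        have h2 := fun hlt => hn'.2 n hlt h
        exact m.toSyn.injective (le_antisymm (not_lt.1 h1) (not_lt.1 h2))
      · intro n _
        rw [map_add, hht]
    · rw [Set.disjoint_left]
      rintro x hx ⟨n, hn, rfl⟩
      exact hn.1 hx
    · exact hfin B
    · exact fun k => (hfin (insert b B) k).subset fun x hx => ⟨himg hx.1, hx.2⟩

/-! ### Pole orders from growth -/

open Asymptotics Filter fwdDiff in
/-- Newton's formula expresses `a (y + N p)` through the differences at `y`; if the differences of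
order above `m` vanish and `a` grows more slowly than `k ^ m`, then the one of order `m` vanishes
as well. -/
lemma fwdDiff_iter_eq_zero_of_growth {a : ℕ → ℚ} {p d m y : ℕ} (hp : 0 < p) (hdm : d < m)
    (hgrowth : (fun k => (a k : ℝ)) =O[atTop] fun k => (k : ℝ) ^ d)
    (hzero : ∀ k, m < k → (Δ_[p])^[k] a y = 0) : (Δ_[p])^[m] a y = 0 := by
  set c : ℕ → ℚ := fun k => (Δ_[p])^[k] a y with hc
  have hnewton : ∀ N : ℕ, (a (y + N * p) : ℝ)
      = ∑ k ∈ Finset.range (m + 1), (N.choose k : ℝ) * (c k : ℝ) := by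
    intro N
    have h1 := shift_eq_sum_fwdDiff_iter p a N y
    rw [smul_eq_mul] at h1
    have h2 : (a (y + N * p) : ℝ)
        = ∑ k ∈ Finset.range (N + 1), (N.choose k : ℝ) * (c k : ℝ) := by
      rw [h1]
      simp [hc]
    rw [h2, Finset.sum_subset (Finset.range_subset_range.2 (Nat.le_max_left (m + 1) (N + 1))),
      Finset.sum_subset (Finset.range_subset_range.2 (Nat.le_max_right (m + 1) (N + 1)))]
    · intro k _ hk
      rw [Nat.choose_eq_zero_of_lt (by rw [Finset.mem_range] at hk; omega)]
      simp
    · intro k _ hk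
      have : c k = 0 := hzero k (by rw [Finset.mem_range] at hk; omega)
      simp [this]
  have hpow : ∀ k, k < m → (fun N : ℕ => (N : ℝ) ^ k) =o[atTop] fun N : ℕ => (N : ℝ) ^ m :=
    fun k hk => (isLittleO_pow_pow_atTop_of_lt hk).comp_tendsto tendsto_natCast_atTop_atTop
  have hlhs : (fun N : ℕ => (a (y + N * p) : ℝ)) =o[atTop] fun N : ℕ => (N : ℝ) ^ m := by
    have htend : Tendsto (fun N : ℕ => y + N * p) atTop atTop :=
      tendsto_atTop_mono (fun N => (Nat.le_mul_of_pos_right N hp).trans le_add_self) tendsto_id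
    refine ((hgrowth.comp_tendsto htend).trans (IsBigO.pow ?_ d)).trans_isLittleO (hpow d hdm)
    refine IsBigO.of_bound ((y : ℝ) + p) ?_
    filter_upwards [eventually_ge_atTop 1] with N hN
    have hN' : (1 : ℝ) ≤ N := by exact_mod_cast hN
    simp only [Nat.cast_add, Nat.cast_mul]
    rw [Real.norm_of_nonneg (by positivity), Real.norm_of_nonneg (by positivity)]
    nlinarith [mul_le_mul_of_nonneg_left hN' (Nat.cast_nonneg (α := ℝ) y)]
  have hlow : (fun N : ℕ => ∑ k ∈ Finset.range m, (N.choose k : ℝ) * (c k : ℝ))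
      =o[atTop] fun N : ℕ => (N : ℝ) ^ m := by
    refine IsLittleO.fun_sum fun k hk => ?_
    simp_rw [mul_comm _ (c k : ℝ)]
    exact ((isTheta_choose k).1.trans_isLittleO (hpow k (Finset.mem_range.1 hk))).const_mul_left _
  have htop : (fun N : ℕ => (c m : ℝ) * (N.choose m : ℝ)) =o[atTop]
      fun N : ℕ => (N.choose m : ℝ) := by
    refine IsLittleO.trans_isBigO ((hlhs.sub hlow).congr_left fun N => ?_) (isTheta_choose m).2
    rw [hnewton, Finset.sum_range_succ]
    ring
  by_contra hne
  have hne' : (c m : ℝ) ≠ 0 := by exact_mod_cast hne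
  rw [isLittleO_const_mul_left_iff hne'] at htop
  refine isLittleO_irrefl (Eventually.frequently ?_) htop
  filter_upwards [eventually_ge_atTop m] with N hN
  exact_mod_cast (Nat.choose_pos hN).ne'

open fwdDiff in
lemma coeff_one_sub_X_pow_pow_mul (p m : ℕ) (F : PowerSeries ℚ) (k : ℕ) :
    PowerSeries.coeff (k + m * p) ((1 - PowerSeries.X ^ p) ^ m * F)
      = (Δ_[p])^[m] (fun k => PowerSeries.coeff k F) k := by
  induction m generalizing k with
  | zero => simp
  | succ m ih =>
    rw [Function.iterate_succ_apply', fwdDiff, ← ih, ← ih, pow_succ', mul_assoc, sub_mul, one_mul,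
      map_sub, show k + (m + 1) * p = k + m * p + p by ring, PowerSeries.coeff_X_pow_mul,
      show k + p + m * p = k + m * p + p by ring]

open fwdDiff in
lemma hasDenominator_iff_fwdDiff {p m : ℕ} {F : PowerSeries ℚ} :
    HasDenominator p m F ↔
      ∃ K, ∀ k, K ≤ k → (Δ_[p])^[m] (fun k => PowerSeries.coeff k F) k = 0 := by
  constructor
  · rintro ⟨δ, hδ⟩
    refine ⟨δ.natDegree + 1, fun k hk => ?_⟩
    rw [← coeff_one_sub_X_pow_pow_mul, hδ, Polynomial.coeff_coe]
    exact Polynomial.coeff_eq_zero_of_natDegree_lt (by omega)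
  · rintro ⟨K, hK⟩
    refine ⟨PowerSeries.trunc (K + m * p) ((1 - PowerSeries.X ^ p) ^ m * F), ?_⟩
    ext k
    rw [Polynomial.coeff_coe, PowerSeries.coeff_trunc]
    split_ifs with hk
    · rfl
    · obtain ⟨l, rfl⟩ := Nat.exists_eq_add_of_le (not_lt.1 hk)
      rw [show K + m * p + l = K + l + m * p by ring, coeff_one_sub_X_pow_pow_mul]
      exact hK _ (Nat.le_add_right _ _)

open Asymptotics Filter fwdDiff in
/-- Polynomial growth of degree `d` of the coefficients bounds all pole orders by `d + 1`. -/
lemma HasDenominator.of_growth {p M d : ℕ} (hp : 0 < p) {F : PowerSeries ℚ}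
    (hF : HasDenominator p M F)
    (hgrowth : (fun k => ((PowerSeries.coeff k F : ℚ) : ℝ)) =O[atTop] fun k => (k : ℝ) ^ d) :
    HasDenominator p (d + 1) F := by
  obtain ⟨K, hK⟩ := hasDenominator_iff_fwdDiff.1 hF
  set a : ℕ → ℚ := fun k => PowerSeries.coeff k F with ha
  have hbig : ∀ j k, K ≤ k → (Δ_[p])^[M + j] a k = 0 := by
    intro j
    induction j with
    | zero => exact hK
    | succ j ih =>
      intro k hk
      rw [← add_assoc, Function.iterate_succ_apply', fwdDiff, ih k hk, ih (k + p) (by omega),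
        sub_zero]
  have key : ∀ j m, d < m → M ≤ m + j → ∀ k, K ≤ k → (Δ_[p])^[m] a k = 0 := by
    intro j
    induction j with
    | zero =>
      intro m _ hm k hk
      obtain ⟨l, rfl⟩ := Nat.exists_eq_add_of_le hm
      exact hbig l k hk
    | succ j ih =>
      intro m hdm hm k hk
      exact fwdDiff_iter_eq_zero_of_growth hp hdm hgrowth
        fun l hl => ih l (by omega) (by omega) k hk
  exact hasDenominator_iff_fwdDiff.2 ⟨K, key M (d + 1) (Nat.lt_succ_self d) (by omega)⟩

/-! ### Lattice points of dilated polytopes -/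

/-- The integer lattice as an additive subgroup. -/
def integerLattice (n : ℕ) : AddSubgroup (Fin n → ℝ) where
  carrier := integerPoints n
  zero_mem' := fun _ => ⟨0, by simp⟩
  add_mem' := fun ha hb i => by
    obtain ⟨z, hz⟩ := ha i
    obtain ⟨w, hw⟩ := hb i
    exact ⟨z + w, by simp [hz, hw]⟩
  neg_mem' := fun ha i => by
    obtain ⟨z, hz⟩ := ha i
    exact ⟨-z, by simp [hz]⟩

/-- A subspace of dimension `d` projects injectively to some `d` coordinates. -/
lemma exists_coordinates_separating {n : ℕ} (W : Submodule ℝ (Fin n → ℝ)) :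
    ∃ I : Finset (Fin n), I.card ≤ Module.finrank ℝ W ∧
      ∀ x ∈ W, (∀ i ∈ I, x i = 0) → x = 0 := by
  classical
  induction h : Module.finrank ℝ W using Nat.strong_induction_on generalizing W with
  | _ d ih =>
    by_cases hW : W = ⊥
    · exact ⟨∅, by simp, fun x hx _ => by simpa [hW] using hx⟩
    · obtain ⟨x, hx, hx0⟩ := W.ne_bot_iff.1 hW
      obtain ⟨i, hi⟩ := Function.ne_iff.1 hx0
      let W' := W ⊓ LinearMap.ker (LinearMap.proj (R := ℝ) (φ := fun _ : Fin n => ℝ) i)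
      have hlt : W' < W := by
        refine lt_of_le_of_ne inf_le_left fun heq => hi ?_
        have : x ∈ W' := heq ▸ hx
        exact this.2
      have hfin := Submodule.finrank_lt_finrank_of_lt hlt
      obtain ⟨I, hI, hsep⟩ := ih _ (h ▸ hfin) W' rfl
      refine ⟨insert i I, ?_, fun y hy h0 => hsep y ⟨hy, ?_⟩ fun j hj => ?_⟩
      · have := Finset.card_insert_le i I
        omega
      · exact h0 i (Finset.mem_insert_self i I)
      · exact h0 j (Finset.mem_insert_of_mem hj)

/-- Lattice points of a `d`-dimensional subspace in a box of side `2R` number at most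
`(2R + 1) ^ d`. -/
lemma integerPoints_box_finite_ncard_le {n : ℕ} (W : Submodule ℝ (Fin n → ℝ)) (R : ℕ)
    {S : Set (Fin n → ℝ)} (hW : S ⊆ W) (hS : S ⊆ integerPoints n)
    (hR : ∀ x ∈ S, ∀ i, |x i| ≤ R) :
    S.Finite ∧ S.ncard ≤ (2 * R + 1) ^ Module.finrank ℝ W := by
  classical
  obtain ⟨I, hI, hsep⟩ := exists_coordinates_separating W
  let T : Finset (I → ℤ) := Fintype.piFinset fun _ => Finset.Icc (-(R : ℤ)) R
  let f : (Fin n → ℝ) → (I → ℤ) := fun x i => ⌊x i⌋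
  have hfl : ∀ x ∈ S, ∀ i, ((⌊x i⌋ : ℤ) : ℝ) = x i := fun x hx i => by
    obtain ⟨z, hz⟩ := hS hx i
    rw [hz, Int.floor_intCast]
  have hmaps : Set.MapsTo f S T := fun x hx => by
    simp only [T, Finset.mem_coe, Fintype.mem_piFinset, Finset.mem_Icc]
    intro i
    have := abs_le.1 (hR x hx i)
    rw [← hfl x hx i] at this
    exact ⟨by exact_mod_cast this.1, by exact_mod_cast this.2⟩
  have hinj : Set.InjOn f S := fun x hx y hy hxy => by
    refine sub_eq_zero.1 (hsep _ (W.sub_mem (hW hx) (hW hy)) fun i hi => ?_)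
    have : f x ⟨i, hi⟩ = f y ⟨i, hi⟩ := by rw [hxy]
    rw [Pi.sub_apply, ← hfl x hx i, ← hfl y hy i, sub_eq_zero]
    exact_mod_cast this
  have hfin : S.Finite := Set.Finite.of_injOn hmaps hinj T.finite_toSet
  refine ⟨hfin, ?_⟩
  calc S.ncard ≤ (T : Set (I → ℤ)).ncard :=
        Set.ncard_le_ncard_of_injOn f hmaps hinj T.finite_toSet
    _ = (2 * R + 1) ^ I.card := by
        rw [Set.ncard_coe_finset, Fintype.card_piFinset]
        simp only [Int.card_Icc, Finset.prod_const, Finset.card_univ, Fintype.card_coe]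
        congr 1
        omega
    _ ≤ _ := Nat.pow_le_pow_right (by omega) hI

lemma IsPolytope.isCompact {n : ℕ} {P : Set (Fin n → ℝ)} (hP : IsPolytope P) : IsCompact P := by
  obtain ⟨V, hV, rfl⟩ := hP
  exact hV.isCompact_convexHull ℝ

lemma IsPolytope.convex {n : ℕ} {P : Set (Fin n → ℝ)} (hP : IsPolytope P) : Convex ℝ P := by
  obtain ⟨V, hV, rfl⟩ := hP
  exact convex_convexHull ℝ V

lemma IsPolytope.finite_extremePoints {n : ℕ} {P : Set (Fin n → ℝ)} (hP : IsPolytope P) :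
    (P.extremePoints ℝ).Finite := by
  obtain ⟨V, hV, rfl⟩ := hP
  exact hV.subset extremePoints_convexHull_subset

lemma IsPolytope.convexHull_extremePoints {n : ℕ} {P : Set (Fin n → ℝ)} (hP : IsPolytope P) :
    convexHull ℝ (P.extremePoints ℝ) = P := by
  rw [← (hP.finite_extremePoints.isClosed_convexHull ℝ).closure_eq]
  exact closure_convexHull_extremePoints hP.isCompact hP.convex

lemma smul_subset_span {n : ℕ} (P : Set (Fin n → ℝ)) (r : ℝ) :
    r • P ⊆ Submodule.span ℝ P := by
  rintro _ ⟨y, hy, rfl⟩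
  exact Submodule.smul_mem _ _ (Submodule.subset_span hy)

lemma smul_set_mono_of_zero_mem {n : ℕ} {P : Set (Fin n → ℝ)} (hP : Convex ℝ P) (h0 : 0 ∈ P)
    {r s : ℝ} (hr : 0 ≤ r) (hrs : r ≤ s) : r • P ⊆ s • P := by
  rintro _ ⟨y, hy, rfl⟩
  rcases hr.eq_or_lt with rfl | hr'
  · exact ⟨0, h0, by simp⟩
  · have hs : 0 < s := hr'.trans_le hrs
    refine ⟨(r / s) • y, hP.smul_mem_of_zero_mem h0 hy ⟨by positivity, (div_le_one hs).2 hrs⟩, ?_⟩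
    simp only [smul_smul]
    rw [mul_div_cancel₀ _ hs.ne']

lemma dim_eq_finrank_span_of_zero_mem {n : ℕ} {P : Set (Fin n → ℝ)} (h0 : 0 ∈ P) :
    dim P = Module.finrank ℝ (Submodule.span ℝ P) := by
  rw [dim, vectorSpan_eq_span_vsub_set_right ℝ h0]
  have : (fun x : Fin n → ℝ => x -ᵥ (0 : Fin n → ℝ)) '' P = P := by
    simp only [vsub_eq_sub]
    exact (Set.image_congr fun x _ => sub_zero x).trans (Set.image_id' P)
  rw [this]

/-- The coefficients of the Ehrhart series grow at most like `k ^ dim P`. -/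
lemma IsPolytope.exists_ncard_le {n : ℕ} {P : Set (Fin n → ℝ)} (hP : IsPolytope P)
    (h0 : 0 ∈ P) : ∃ R : ℕ, ∀ k : ℕ, (((k : ℝ) • P) ∩ integerPoints n).Finite ∧
      (((k : ℝ) • P) ∩ integerPoints n).ncard ≤ (2 * (k * R) + 1) ^ dim P := by
  obtain ⟨C, hC⟩ := hP.isCompact.isBounded.exists_norm_le
  obtain ⟨R, hR⟩ := exists_nat_ge C
  refine ⟨R, fun k => ?_⟩
  rw [dim_eq_finrank_span_of_zero_mem h0]
  refine integerPoints_box_finite_ncard_le _ (k * R)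
    (Set.inter_subset_left.trans (smul_subset_span P k)) Set.inter_subset_right ?_
  rintro _ ⟨⟨y, hy, rfl⟩, -⟩ i
  simp only [Pi.smul_apply, smul_eq_mul, abs_mul, Nat.abs_cast, Nat.cast_mul]
  exact mul_le_mul_of_nonneg_left ((norm_le_pi_norm y i).trans ((hC y hy).trans hR))
    (Nat.cast_nonneg k)

lemma ehrhartSeries_coeff {n : ℕ} {P : Set (Fin n → ℝ)} (h0 : 0 ∈ P) (k : ℕ) :
    PowerSeries.coeff k (ehrhartSeries P) = ((((k : ℝ) • P) ∩ integerPoints n).ncard : ℚ) := by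
  rw [ehrhartSeries, PowerSeries.coeff_mk]
  split_ifs with hk
  · subst hk
    rw [Nat.cast_zero, Set.zero_smul_set ⟨0, h0⟩, Set.inter_eq_left.2]
    · rw [← Set.singleton_zero, Set.ncard_singleton, Nat.cast_one]
    · rintro _ rfl
      exact (integerLattice n).zero_mem
  · rfl

/-! ### Ehrhart's theorem -/

/-- The graded monoid of lattice points in the cone over `P`: pairs `(x, k)` with `x ∈ kP`
integral. -/
def latticeCone {n : ℕ} (P : Set (Fin n → ℝ)) (hP : Convex ℝ P) (h0 : 0 ∈ P) :
    AddSubmonoid ((Fin n → ℝ) × ℕ) where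
  carrier := {z | z.1 ∈ ((z.2 : ℝ) • P) ∩ integerPoints n}
  zero_mem' := ⟨⟨0, h0, by simp⟩, (integerLattice n).zero_mem⟩
  add_mem' := fun {a b} ha hb => by
    refine ⟨?_, (integerLattice n).add_mem ha.2 hb.2⟩
    rw [Prod.snd_add, Nat.cast_add, hP.add_smul (Nat.cast_nonneg _) (Nat.cast_nonneg _)]
    exact Set.add_mem_add ha.1 hb.1

lemma sum_smul_mem_smul_set {n : ℕ} {ι : Type*} {P : Set (Fin n → ℝ)} (hP : Convex ℝ P)
    (h0 : 0 ∈ P) (s : Finset ι) {c : ι → ℝ} {v : ι → Fin n → ℝ} (hc : ∀ i ∈ s, 0 ≤ c i)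
    (hv : ∀ i ∈ s, v i ∈ P) : ∑ i ∈ s, c i • v i ∈ (∑ i ∈ s, c i) • P := by
  classical
  induction s using Finset.induction_on with
  | empty => exact ⟨0, h0, by simp⟩
  | insert i s hi ih =>
    rw [Finset.sum_insert hi, Finset.sum_insert hi, hP.add_smul (hc i (Finset.mem_insert_self i s))
      (Finset.sum_nonneg fun j hj => hc j (Finset.mem_insert_of_mem hj))]
    exact Set.add_mem_add (Set.smul_mem_smul_set (hv i (Finset.mem_insert_self i s)))
      (ih (fun j hj => hc j (Finset.mem_insert_of_mem hj))
        fun j hj => hv j (Finset.mem_insert_of_mem hj))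

lemma exists_sum_smul_of_mem_smul_convexHull {n M : ℕ} {v : Fin M → Fin n → ℝ} {r : ℝ}
    (hr : 0 ≤ r) {x : Fin n → ℝ} (hx : x ∈ r • convexHull ℝ (Set.range v)) :
    ∃ c : Fin M → ℝ, (∀ i, 0 ≤ c i) ∧ ∑ i, c i = r ∧ x = ∑ i, c i • v i := by
  obtain ⟨y, hy, rfl⟩ := hx
  rw [convexHull_range_eq_exists_affineCombination] at hy
  obtain ⟨s, w, hw, hw1, rfl⟩ := hy
  refine ⟨fun i => if i ∈ s then r * w i else 0, fun i => ?_, ?_, ?_⟩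
  · dsimp only
    split_ifs with hi
    · exact mul_nonneg hr (hw i hi)
    · exact le_rfl
  · rw [Finset.sum_ite_mem, Finset.univ_inter, ← Finset.mul_sum, hw1, mul_one]
  · rw [s.affineCombination_eq_linear_combination v w hw1]
    simp only [ite_smul, zero_smul, Finset.smul_sum]
    rw [Finset.sum_ite_mem, Finset.univ_inter]
    exact Finset.sum_congr rfl fun i _ => smul_smul _ _ _

lemma ehrhartSeries_eq_countSeries {n : ℕ} {P : Set (Fin n → ℝ)} (hP : Convex ℝ P)
    (h0 : 0 ∈ P) : ehrhartSeries P =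
      countSeries (latticeCone P hP h0 : Set ((Fin n → ℝ) × ℕ))
        (AddMonoidHom.snd (Fin n → ℝ) ℕ) := by
  ext k
  rw [ehrhartSeries_coeff h0, countSeries, PowerSeries.coeff_mk]
  have : {z | z ∈ (latticeCone P hP h0 : Set ((Fin n → ℝ) × ℕ)) ∧
      AddMonoidHom.snd (Fin n → ℝ) ℕ z = k}
      = (fun x => (x, k)) '' (((k : ℝ) • P) ∩ integerPoints n) := by
    ext ⟨x, l⟩
    constructor
    · rintro ⟨hz, rfl⟩
      exact ⟨x, hz, rfl⟩
    · rintro ⟨y, hy, hyz⟩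
      obtain ⟨rfl, rfl⟩ := Prod.mk.inj hyz
      exact ⟨hy, rfl⟩
  rw [this, Set.InjOn.ncard_image fun a _ b _ hab => (Prod.mk.inj hab).1]

/-- The lattice points of the cone over `P` are generated by those of bounded height under
translation by the vectors `(p v_i, p)`: subtract the integer parts of the coefficients of a
conical combination. -/
lemma exists_generators_latticeCone {n M p : ℕ} (hp : 0 < p) {P : Set (Fin n → ℝ)}
    (hP : IsPolytope P) (h0 : 0 ∈ P) {v : Fin M → Fin n → ℝ} (hv : P = convexHull ℝ (Set.range v))
    (hpv : ∀ i, (p : ℝ) • v i ∈ integerPoints n) :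
    ∃ B : Finset ((Fin n → ℝ) × ℕ), {x | ∃ b ∈ B, ∃ m : Fin M →₀ ℕ,
      x = b + Finsupp.linearCombination ℕ (fun i => ((p : ℝ) • v i, p)) m}
        = (latticeCone P hP.convex h0 : Set ((Fin n → ℝ) × ℕ)) := by
  classical
  set S := latticeCone P hP.convex h0 with hSdef
  obtain ⟨R, hR⟩ := hP.exists_ncard_le h0
  have hp' : (0 : ℝ) < p := by exact_mod_cast hp
  have hvP : ∀ i, v i ∈ P := fun i => hv ▸ subset_convexHull ℝ _ (Set.mem_range_self i)
  let w : Fin M → (Fin n → ℝ) × ℕ := fun i => ((p : ℝ) • v i, p)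
  have hwS : ∀ i, w i ∈ S := fun i => ⟨Set.smul_mem_smul_set (hvP i), hpv i⟩
  have hBfin : {z | z ∈ S ∧ z.2 ≤ p * M}.Finite := by
    refine ((Set.finite_Iic (p * M)).biUnion fun k _ =>
      ((hR k).1.image fun x => (x, k))).subset ?_
    rintro ⟨x, k⟩ ⟨hz, hk⟩
    simp only [Set.mem_iUnion]
    exact ⟨k, hk, x, hz, rfl⟩
  have hN : ∀ m : Fin M →₀ ℕ, Finsupp.linearCombination ℕ w m
      = (∑ i, ((m i : ℝ) * p) • v i, ∑ i, m i * p) := fun m => by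
    rw [Finsupp.linearCombination_apply, Finsupp.sum_fintype _ _ (by simp)]
    ext
    · simp [w, Prod.fst_sum, mul_assoc, mul_left_comm]
    · simp [w, Prod.snd_sum]
  refine ⟨hBfin.toFinset, ?_⟩
  ext z
  constructor
  · rintro ⟨b, hb, m, rfl⟩
    rw [Set.Finite.mem_toFinset] at hb
    refine S.add_mem hb.1 ?_
    rw [Finsupp.linearCombination_apply]
    exact S.sum_mem fun i _ => S.nsmul_mem (hwS i) _
  · intro hz
    obtain ⟨x, k⟩ := z
    have hx : x ∈ (k : ℝ) • P := hz.1
    rw [hv] at hx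
    obtain ⟨c, hc, hck, hcx⟩ := exists_sum_smul_of_mem_smul_convexHull (Nat.cast_nonneg k) hx
    let m : Fin M →₀ ℕ := Finsupp.equivFunOnFinite.symm fun i => ⌊c i / p⌋₊
    have hm : ∀ i, (m i : ℝ) * p ≤ c i := fun i =>
      (le_div_iff₀ hp').1 (Nat.floor_le (div_nonneg (hc i) hp'.le))
    have hm' : ∀ i, c i ≤ (m i : ℝ) * p + p := fun i => by
      have := (div_lt_iff₀ hp').1 (Nat.lt_floor_add_one (c i / p))
      rw [add_mul, one_mul] at this
      exact this.le
    have hsum : ∑ i, m i * p ≤ k := by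
      have : ((∑ i, m i * p : ℕ) : ℝ) ≤ k := by
        rw [← hck]
        push_cast
        exact Finset.sum_le_sum fun i _ => hm i
      exact_mod_cast this
    have hkey : (x - ∑ i, ((m i : ℝ) * p) • v i) ∈ ((k - ∑ i, m i * p : ℕ) : ℝ) • P := by
      have := sum_smul_mem_smul_set hP.convex h0 Finset.univ
        (c := fun i => c i - m i * p) (fun i _ => sub_nonneg.2 (hm i)) (fun i _ => hvP i)
      rw [Finset.sum_sub_distrib, hck] at this
      simp only [sub_smul, Finset.sum_sub_distrib] at this
      rw [← hcx] at this
      rw [Nat.cast_sub hsum]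
      push_cast
      exact this
    refine ⟨(x - ∑ i, ((m i : ℝ) * p) • v i, k - ∑ i, m i * p), ?_, m, ?_⟩
    · rw [Set.Finite.mem_toFinset]
      refine ⟨⟨hkey, (integerLattice n).sub_mem hz.2 ?_⟩, ?_⟩
      · refine (integerLattice n).sum_mem fun i _ => ?_
        rw [mul_smul, Nat.cast_smul_eq_nsmul]
        exact (integerLattice n).nsmul_mem (hpv i) _
      · have : (k : ℝ) ≤ ((∑ i, m i * p + p * M : ℕ) : ℝ) := by
          rw [← hck]
          push_cast
          calc ∑ i, c i ≤ ∑ i, ((m i : ℝ) * p + p) := Finset.sum_le_sum fun i _ => hm' i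
            _ = _ := by
              rw [Finset.sum_add_distrib, Finset.sum_const, Finset.card_univ, Fintype.card_fin,
                nsmul_eq_mul, mul_comm (M : ℝ)]
        have : k ≤ ∑ i, m i * p + p * M := by exact_mod_cast this
        change k - ∑ i, m i * p ≤ p * M
        omega
    · rw [hN]
      ext1
      · simp
      · exact (Nat.sub_add_cancel hsum).symm

/-- A weak form of Ehrhart's theorem. -/
lemma hasDenominator_ehrhartSeries_of_range {n M p : ℕ} (hp : 0 < p) {P : Set (Fin n → ℝ)}
    (hP : IsPolytope P) (h0 : 0 ∈ P) {v : Fin M → Fin n → ℝ} (hv : P = convexHull ℝ (Set.range v))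
    (hpv : ∀ i, (p : ℝ) • v i ∈ integerPoints n) :
    HasDenominator p M (ehrhartSeries P) := by
  obtain ⟨B, hB⟩ := exists_generators_latticeCone hp hP h0 hv hpv
  rw [ehrhartSeries_eq_countSeries hP.convex h0, ← hB]
  exact hasDenominator_finitely_generated hp (AddMonoidHom.snd (Fin n → ℝ) ℕ)
    (fun i => ((p : ℝ) • v i, p)) (fun _ => rfl) B

open Asymptotics Filter in
/-- Ehrhart's theorem for a rational polytope containing the origin; the exponent comes from the
growth of the number of lattice points. -/
theorem hasDenominator_ehrhartSeries {n p : ℕ} (hp : 0 < p) {P : Set (Fin n → ℝ)}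
    (hP : IsPolytope P) (h0 : 0 ∈ P)
    (hpP : ∀ v ∈ P.extremePoints ℝ, (p : ℝ) • v ∈ integerPoints n) :
    HasDenominator p (dim P + 1) (ehrhartSeries P) := by
  have := hP.finite_extremePoints.fintype
  let e := (Fintype.equivFin (P.extremePoints ℝ)).symm
  have hF : HasDenominator p (Fintype.card (P.extremePoints ℝ)) (ehrhartSeries P) := by
    refine hasDenominator_ehrhartSeries_of_range (v := fun i => (e i : Fin n → ℝ)) hp hP h0 ?_
      fun i => hpP _ (e i).2
    have : Set.range (fun i => (e i : Fin n → ℝ)) = P.extremePoints ℝ := by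
      rw [← Function.comp_def Subtype.val e, Set.range_comp, e.surjective.range_eq, Set.image_univ,
        Subtype.range_coe]
    rw [this, hP.convexHull_extremePoints]
  refine hF.of_growth hp ?_
  obtain ⟨R, hR⟩ := hP.exists_ncard_le h0
  have hlin : (fun k : ℕ => (2 * (k * R) + 1 : ℝ)) =O[atTop] fun k : ℕ => (k : ℝ) := by
    refine IsBigO.of_bound (2 * R + 1) ?_
    filter_upwards [eventually_ge_atTop 1] with k hk
    have hk' : (1 : ℝ) ≤ k := by exact_mod_cast hk
    rw [Real.norm_of_nonneg (by positivity), Real.norm_of_nonneg (by positivity)]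
    linarith
  refine IsBigO.trans (IsBigO.of_bound 1 (Eventually.of_forall fun k => ?_)) (hlin.pow (dim P))
  rw [ehrhartSeries_coeff h0, one_mul, Rat.cast_natCast, Real.norm_of_nonneg (by positivity),
    Real.norm_of_nonneg (by positivity)]
  exact_mod_cast (hR k).2

/-! ### Vertices of the polar dual and integrality of the gauge -/

/-- Moving along `u` from a point `φ` of the polar dual, where `u` vanishes at the
constraints tight at `φ` and is positive at some other one, one reaches a point where an
additional constraint is tight. -/
lemma exists_tight_of_pos {E : Type*} [AddCommGroup E] [Module ℝ E] (V : Finset E)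
    {φ u : Module.Dual ℝ E} (hφ : ∀ v ∈ V, φ v ≤ 1)
    (hu0 : ∀ v ∈ V, φ v = 1 → u v = 0) (hpos : ∃ v ∈ V, 0 < u v) :
    ∃ s : ℝ, 0 ≤ s ∧ (∀ v ∈ V, (φ + s • u) v ≤ 1) ∧ ∃ v ∈ V, φ v ≠ 1 ∧ (φ + s • u) v = 1 := by
  classical
  obtain ⟨v₀, hv₀, hv₀u⟩ := hpos
  obtain ⟨v, hv, hmin⟩ := (V.filter fun v => 0 < u v).exists_min_image
    (fun v => (1 - φ v) / u v) ⟨v₀, Finset.mem_filter.2 ⟨hv₀, hv₀u⟩⟩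
  obtain ⟨hvV, hvu⟩ := Finset.mem_filter.1 hv
  have hs : 0 ≤ (1 - φ v) / u v := div_nonneg (sub_nonneg.2 (hφ v hvV)) hvu.le
  refine ⟨(1 - φ v) / u v, hs, fun x hx => ?_, v, hvV, fun h => ?_, ?_⟩
  · rw [LinearMap.add_apply, LinearMap.smul_apply, smul_eq_mul]
    by_cases hxu : 0 < u x
    · have := (le_div_iff₀ hxu).1 (hmin x (Finset.mem_filter.2 ⟨hx, hxu⟩))
      linarith
    · have := mul_nonpos_of_nonneg_of_nonpos hs (not_lt.1 hxu)
      linarith [hφ x hx]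
  · exact hvu.ne' (hu0 v hvV h)
  · rw [LinearMap.add_apply, LinearMap.smul_apply, smul_eq_mul, div_mul_cancel₀ _ hvu.ne']
    ring

/-- A functional that is bounded above on a polyhedron `{φ | ∀ v ∈ V, φ v ≤ 1}` without lines is
dominated by its value at some vertex: from a point that is not a vertex, move in a direction
that keeps the tight constraints and does not decrease the functional. -/
lemma exists_extremePoint_ge {E : Type*} [AddCommGroup E] [Module ℝ E] (V : Finset E)
    (hV : Submodule.span ℝ (V : Set E) = ⊤) (x : E) (r : ℝ)
    (hbound : ∀ φ : Module.Dual ℝ E, (∀ v ∈ V, φ v ≤ 1) → φ x ≤ r)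
    (φ : Module.Dual ℝ E) (hφ : ∀ v ∈ V, φ v ≤ 1) :
    ∃ ψ ∈ {ψ : Module.Dual ℝ E | ∀ v ∈ V, ψ v ≤ 1}.extremePoints ℝ, φ x ≤ ψ x := by
  classical
  induction hN : (V.filter fun v => φ v ≠ 1).card using Nat.strong_induction_on generalizing φ with
  | _ N ih =>
    by_cases hspan : ∀ u : Module.Dual ℝ E, (∀ v ∈ V, φ v = 1 → u v = 0) → u = 0
    · refine ⟨φ, ⟨hφ, ?_⟩, le_rfl⟩
      rintro ψ₁ hψ₁ ψ₂ hψ₂ ⟨a, b, ha, hb, hab, hφe⟩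
      refine sub_eq_zero.1 (hspan _ fun v hv htight => ?_)
      have h1 := hψ₁ v hv
      have h2 := hψ₂ v hv
      have h3 : a * ψ₁ v + b * ψ₂ v = 1 := by
        rw [← htight, ← hφe]
        simp
      rw [LinearMap.sub_apply, htight]
      nlinarith
    · push Not at hspan
      obtain ⟨u, hu0, hu⟩ := hspan
      -- Replacing `u` by `-u`, the direction is nondecreasing for `x` and leaves the polyhedron.
      have hdir : ∃ w : Module.Dual ℝ E, (∀ v ∈ V, φ v = 1 → w v = 0) ∧ 0 ≤ w x ∧
          ∃ v ∈ V, 0 < w v := by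
        have hne : ∃ v ∈ V, u v ≠ 0 := by
          by_contra! hall
          refine hu (LinearMap.ext_on hV fun v hv => ?_)
          rw [hall v hv, LinearMap.zero_apply]
        have hray : ∀ w : Module.Dual ℝ E, (∀ v ∈ V, w v ≤ 0) → w x ≤ 0 := by
          intro w hw
          by_contra! hwx
          have := hbound (((|r| + 1) / w x) • w) fun v hv => by
            rw [LinearMap.smul_apply, smul_eq_mul]
            have := mul_nonpos_of_nonneg_of_nonpos
              (div_nonneg (by positivity : (0 : ℝ) ≤ |r| + 1) hwx.le) (hw v hv)
            linarith
          rw [LinearMap.smul_apply, smul_eq_mul, div_mul_cancel₀ _ hwx.ne'] at this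
          linarith [le_abs_self r]
        have hneg : ∀ v ∈ V, φ v = 1 → (-u) v = 0 := fun v hv h => by
          rw [LinearMap.neg_apply, hu0 v hv h, neg_zero]
        by_cases hp : ∃ v ∈ V, 0 < u v
        · by_cases hm : ∃ v ∈ V, 0 < (-u) v
          · rcases le_total 0 (u x) with hx | hx
            · exact ⟨u, hu0, hx, hp⟩
            · exact ⟨-u, hneg, by rw [LinearMap.neg_apply]; linarith, hm⟩
          · push Not at hm
            have := hray (-u) hm
            rw [LinearMap.neg_apply] at this
            exact ⟨u, hu0, by linarith, hp⟩
        · push Not at hp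
          obtain ⟨v, hv, hvu⟩ := hne
          refine ⟨-u, hneg, ?_, v, hv, ?_⟩
          · rw [LinearMap.neg_apply]
            linarith [hray u hp]
          · rw [LinearMap.neg_apply]
            exact neg_pos.2 (lt_of_le_of_ne (hp v hv) hvu)
      obtain ⟨w, hw0, hwx, hwpos⟩ := hdir
      obtain ⟨s, hs, hle, v, hv, hvne, hveq⟩ := exists_tight_of_pos V hφ hw0 hwpos
      have hcard : (V.filter fun v => (φ + s • w) v ≠ 1).card < N := by
        rw [← hN]
        refine Finset.card_lt_card ((Finset.ssubset_iff_of_subset fun y hy => ?_).2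
          ⟨v, Finset.mem_filter.2 ⟨hv, hvne⟩, fun h => (Finset.mem_filter.1 h).2 hveq⟩)
        obtain ⟨hyV, hy1⟩ := Finset.mem_filter.1 hy
        refine Finset.mem_filter.2 ⟨hyV, fun h => hy1 ?_⟩
        rw [LinearMap.add_apply, LinearMap.smul_apply, hw0 y hyV h, h]
        simp
      obtain ⟨ψ, hψ, hge⟩ := ih _ hcard (φ + s • w) hle rfl
      refine ⟨ψ, hψ, le_trans ?_ hge⟩
      rw [LinearMap.add_apply, LinearMap.smul_apply, smul_eq_mul]
      have := mul_nonneg hs hwx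
      linarith

/-- Evaluation at a point of `r • P` is at most `r` on the polar dual. -/
lemma polarDual_apply_le {n : ℕ} {P : Set (Fin n → ℝ)} {r : ℝ} (hr : 0 ≤ r)
    {φ : Module.Dual ℝ (Submodule.span ℝ P)} (hφ : φ ∈ polarDual P)
    {x : Submodule.span ℝ P} (hx : (x : Fin n → ℝ) ∈ r • P) : φ x ≤ r := by
  obtain ⟨y, hy, hyx⟩ := hx
  have : x = r • (⟨y, Submodule.subset_span hy⟩ : Submodule.span ℝ P) := Subtype.ext hyx.symm
  rw [this, map_smul, smul_eq_mul]
  exact mul_le_of_le_one_right hr (hφ _ hy)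

lemma exists_polarDual_gt {n : ℕ} {P : Set (Fin n → ℝ)} (hP : IsPolytope P) (h0 : 0 ∈ P)
    {c : ℝ} (hc : 0 < c) {x : Submodule.span ℝ P} (hx : (x : Fin n → ℝ) ∉ c • P) :
    ∃ φ ∈ polarDual P, c < φ x := by
  have hx' : c⁻¹ • (x : Fin n → ℝ) ∉ P := fun h =>
    hx ((Set.mem_smul_set_iff_inv_smul_mem₀ hc.ne' _ _).2 h)
  obtain ⟨f, u, hfu, hux⟩ :=
    geometric_hahn_banach_closed_point hP.convex hP.isCompact.isClosed hx'
  have hu : 0 < u := by simpa using hfu 0 h0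
  refine ⟨u⁻¹ • (f : (Fin n → ℝ) →ₗ[ℝ] ℝ).comp (Submodule.span ℝ P).subtype, fun a ha => ?_, ?_⟩
  · simp only [LinearMap.smul_apply, LinearMap.comp_apply, Submodule.subtype_apply, smul_eq_mul,
      ContinuousLinearMap.coe_coe]
    rw [inv_mul_le_iff₀ hu, mul_one]
    exact (hfu _ ha).le
  · simp only [LinearMap.smul_apply, LinearMap.comp_apply, Submodule.subtype_apply, smul_eq_mul,
      ContinuousLinearMap.coe_coe]
    rw [map_smul, smul_eq_mul, lt_inv_mul_iff₀ hc] at hux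
    rw [lt_inv_mul_iff₀ hu, mul_comm]
    exact hux

/-- The polar dual of a polytope is cut out by finitely many inequalities `φ v ≤ 1`, and it
contains no line since these `v` span. -/
lemma IsPolytope.exists_finset_polarDual_eq {n : ℕ} {P : Set (Fin n → ℝ)} (hP : IsPolytope P) :
    ∃ V : Finset (Submodule.span ℝ P), Submodule.span ℝ (V : Set (Submodule.span ℝ P)) = ⊤ ∧
      polarDual P = {ψ | ∀ v ∈ V, ψ v ≤ 1} := by
  obtain ⟨V₀, hV₀, rfl⟩ := hP
  set W := Submodule.span ℝ (convexHull ℝ V₀) with hW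
  have hV₀W : V₀ ⊆ W := (subset_convexHull ℝ V₀).trans Submodule.subset_span
  have hfin : ((↑) ⁻¹' V₀ : Set W).Finite := hV₀.preimage Subtype.coe_injective.injOn
  set V : Finset W := hfin.toFinset with hVdef
  have hmemV : ∀ v : W, v ∈ V ↔ (v : Fin n → ℝ) ∈ V₀ := fun v => by
    rw [hVdef, Set.Finite.mem_toFinset, Set.mem_preimage]
  have hspanV : Submodule.span ℝ (V : Set W) = ⊤ := by
    have himg : W.subtype '' (V : Set W) = V₀ := by
      ext y
      constructor
      · rintro ⟨v, hv, rfl⟩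
        exact (hmemV v).1 hv
      · exact fun hy => ⟨⟨y, hV₀W hy⟩, (hmemV _).2 hy, rfl⟩
    apply Submodule.map_injective_of_injective W.injective_subtype
    rw [Submodule.map_span, himg, Submodule.map_top, Submodule.range_subtype]
    refine le_antisymm (Submodule.span_mono (subset_convexHull ℝ V₀)) ?_
    exact Submodule.span_le.2 (convexHull_min Submodule.subset_span
      (Submodule.span ℝ V₀).convex)
  have hpolar : polarDual (convexHull ℝ V₀) = {ψ : Module.Dual ℝ W | ∀ v ∈ V, ψ v ≤ 1} := by
    ext ψ
    constructor
    · exact fun hψ v hv => hψ v (subset_convexHull ℝ V₀ ((hmemV v).1 hv))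
    · intro hψ a ha
      obtain ⟨f, hf⟩ := LinearMap.exists_extend ψ
      have hfψ : ∀ w : W, f w = ψ w := fun w => by rw [← hf]; rfl
      have hconv : convexHull ℝ V₀ ⊆ {y | f y ≤ 1} :=
        convexHull_min (fun y hy => by
          have := hψ ⟨y, hV₀W hy⟩ ((hmemV _).2 hy)
          rwa [← hfψ] at this) (convex_halfSpace_le f.isLinear 1)
      rw [← hfψ]
      exact hconv ha
  exact ⟨V, hspanV, hpolar⟩

/-- If the vertices of the polar dual are integral, the gauge of `P` takes integer values at
lattice points: a lattice point of `r • P` lies in `⌊r⌋ • P`. Otherwise some functional in the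
polar dual, hence one of its vertices, has a value strictly between `⌊r⌋` and `⌊r⌋ + 1` there. -/
lemma mem_floor_smul_of_dualIsLatticePolyhedron {n : ℕ} {P : Set (Fin n → ℝ)} (hP : IsPolytope P)
    (h0 : 0 ∈ P) (hdual : DualIsLatticePolyhedron P) {r : ℝ} (hr : 0 ≤ r) {x : Fin n → ℝ}
    (hx : x ∈ r • P) (hxZ : x ∈ integerPoints n) : x ∈ (⌊r⌋₊ : ℝ) • P := by
  classical
  by_contra hxm
  lift x to Submodule.span ℝ P using smul_subset_span P r hx
  obtain ⟨φ, hφ, hφx⟩ : ∃ φ ∈ polarDual P, (⌊r⌋₊ : ℝ) < φ x := by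
    rcases Nat.eq_zero_or_pos ⌊r⌋₊ with hm | hm
    · rw [hm, Nat.cast_zero, Set.zero_smul_set ⟨0, h0⟩] at hxm
      have hxpos : 0 < ‖(x : Fin n → ℝ)‖ := norm_pos_iff.2 hxm
      obtain ⟨C, hC⟩ := hP.isCompact.isBounded.exists_norm_le
      have hC1 : 0 < max C 1 := lt_max_of_lt_right one_pos
      -- `P` is bounded, so a nonzero point leaves small multiples of `P`.
      set c := ‖(x : Fin n → ℝ)‖ / (2 * max C 1) with hc
      have hcpos : 0 < c := by positivity
      obtain ⟨φ, hφ, hlt⟩ := exists_polarDual_gt hP h0 hcpos (x := x) fun ⟨y, hy, hyx⟩ => by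
        have h1 : ‖(x : Fin n → ℝ)‖ = c * ‖y‖ := by
          rw [← hyx, norm_smul, Real.norm_of_nonneg hcpos.le]
        have h2 : c * ‖y‖ ≤ c * max C 1 :=
          mul_le_mul_of_nonneg_left ((hC y hy).trans (le_max_left _ _)) hcpos.le
        have h3 : c * max C 1 = ‖(x : Fin n → ℝ)‖ / 2 := by
          rw [hc]
          field_simp
        linarith
      exact ⟨φ, hφ, by rw [hm, Nat.cast_zero]; exact hcpos.trans hlt⟩
    · exact exists_polarDual_gt hP h0 (by exact_mod_cast hm) hxm
  obtain ⟨V, hspanV, hpolar⟩ := hP.exists_finset_polarDual_eq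
  have hle : ∀ ψ ∈ polarDual P, ψ x ≤ r := fun ψ hψ => polarDual_apply_le hr hψ hx
  obtain ⟨ψ, hψ, hge⟩ := exists_extremePoint_ge V hspanV x r
    (fun ψ hψ => hle ψ (hpolar.symm.subset hψ)) φ (hpolar.subset hφ)
  rw [← hpolar] at hψ
  obtain ⟨z, hz⟩ := hdual hψ x hxZ
  have h1 : (⌊r⌋₊ : ℝ) < z := by rw [← hz]; exact hφx.trans_le hge
  have h2 : (z : ℝ) < ⌊r⌋₊ + 1 := by
    rw [← hz]
    exact (hle ψ hψ.1).trans_lt (Nat.lt_floor_add_one r)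
  have h1' : (⌊r⌋₊ : ℤ) < z := by exact_mod_cast h1
  have h2' : z < (⌊r⌋₊ : ℤ) + 1 := by exact_mod_cast h2
  omega

/-! ### Denominators -/

lemma extremePoints_smul_set {n : ℕ} (P : Set (Fin n → ℝ)) {c : ℝ} (hc : c ≠ 0) :
    (c • P).extremePoints ℝ = c • P.extremePoints ℝ :=
  (image_extremePoints (LinearEquiv.smulOfNeZero ℝ (Fin n → ℝ) c hc) P).symm

lemma IsPolytope.smul {n : ℕ} {P : Set (Fin n → ℝ)} (hP : IsPolytope P) (c : ℝ) :
    IsPolytope (c • P) := by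
  obtain ⟨V, hV, rfl⟩ := hP
  exact ⟨c • V, hV.smul_set, (convexHull_smul c V).symm⟩

lemma isLatticePolytope_smul_iff {n : ℕ} {P : Set (Fin n → ℝ)} (hP : IsPolytope P) {m : ℕ}
    (hm : 0 < m) : IsLatticePolytope ((m : ℝ) • P) ↔
      ∀ v ∈ P.extremePoints ℝ, (m : ℝ) • v ∈ integerPoints n := by
  rw [IsLatticePolytope, and_iff_right (hP.smul _),
    extremePoints_smul_set P (Nat.cast_ne_zero.2 hm.ne')]
  refine ⟨fun h v hv => h (Set.smul_mem_smul_set hv), fun h => ?_⟩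
  rintro _ ⟨v, hv, rfl⟩
  exact h v hv

lemma exists_pos_smul_mem_integerPoints {n : ℕ} {S : Set (Fin n → ℝ)} (hS : S.Finite)
    (hrat : S ⊆ rationalPoints n) :
    ∃ m : ℕ, 0 < m ∧ ∀ v ∈ S, (m : ℝ) • v ∈ integerPoints n := by
  induction S, hS using Set.Finite.induction_on with
  | empty => exact ⟨1, one_pos, by simp⟩
  | @insert a S _ _ ih =>
    obtain ⟨m, hm, hmS⟩ := ih ((Set.subset_insert a S).trans hrat)
    choose q hq using hrat (Set.mem_insert a S)
    have hd : 0 < ∏ i, (q i).den := Finset.prod_pos fun i _ => (q i).den_pos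
    refine ⟨m * ∏ i, (q i).den, Nat.mul_pos hm hd, ?_⟩
    rintro v (rfl | hv)
    · rw [Nat.cast_mul, mul_smul, Nat.cast_smul_eq_nsmul]
      refine (integerLattice n).nsmul_mem (fun i => ?_) _
      obtain ⟨c, hc⟩ := Finset.dvd_prod_of_mem (fun i => (q i).den) (Finset.mem_univ i)
      refine ⟨c * (q i).num, ?_⟩
      have := Rat.den_mul_eq_num (q i)
      rw [Pi.smul_apply, smul_eq_mul, hc, hq i]
      push_cast
      rw [mul_comm ((q i).den : ℝ), mul_assoc]
      congr 1
      exact_mod_cast this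
    · rw [Nat.cast_mul, mul_comm, mul_smul, Nat.cast_smul_eq_nsmul]
      exact (integerLattice n).nsmul_mem (hmS v hv) _

lemma IsRationalPolytope.den_mem {n : ℕ} {P : Set (Fin n → ℝ)} (hP : IsRationalPolytope P) :
    0 < den P ∧ IsLatticePolytope ((den P : ℝ) • P) := by
  obtain ⟨m, hm, hmP⟩ := exists_pos_smul_mem_integerPoints hP.1.finite_extremePoints hP.2
  exact Nat.sInf_mem (s := {m : ℕ | 0 < m ∧ IsLatticePolytope ((m : ℝ) • P)})
    ⟨m, hm, (isLatticePolytope_smul_iff hP.1 hm).2 hmP⟩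

lemma IsRationalPolytope.isLatticePolytope_smul_iff_den_dvd {n : ℕ} {P : Set (Fin n → ℝ)}
    (hP : IsRationalPolytope P) {m : ℕ} (hm : 0 < m) :
    IsLatticePolytope ((m : ℝ) • P) ↔ den P ∣ m := by
  obtain ⟨hd, hdP⟩ := hP.den_mem
  rw [isLatticePolytope_smul_iff hP.1 hd] at hdP
  rw [isLatticePolytope_smul_iff hP.1 hm]
  constructor
  · intro hmP
    refine Nat.dvd_of_mod_eq_zero (by_contra fun hne => ?_)
    have hpos : 0 < m % den P := Nat.pos_of_ne_zero hne
    refine (Nat.mod_lt m hd).not_ge (Nat.sInf_le ⟨hpos, ?_⟩)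
    refine (isLatticePolytope_smul_iff hP.1 hpos).2 fun v hv => ?_
    have hmod : ((m % den P : ℕ) : ℝ) • v = (m : ℝ) • v - (m / den P) • ((den P : ℝ) • v) := by
      rw [← Nat.cast_smul_eq_nsmul ℝ, smul_smul, ← sub_smul]
      congr 1
      rw [eq_sub_iff_add_eq, mul_comm]
      exact_mod_cast Nat.mod_add_div m (den P)
    rw [hmod]
    exact (integerLattice n).sub_mem (hmP v hv) ((integerLattice n).nsmul_mem (hdP v hv) _)
  · rintro ⟨c, rfl⟩ v hv
    rw [Nat.cast_mul, mul_comm, mul_smul, Nat.cast_smul_eq_nsmul]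
    exact (integerLattice n).nsmul_mem (hdP v hv) _

lemma IsLatticePolytope.den_eq_one {n : ℕ} {P : Set (Fin n → ℝ)} (hP : IsRationalPolytope P)
    (hlat : IsLatticePolytope P) : den P = 1 :=
  Nat.dvd_one.1 ((hP.isLatticePolytope_smul_iff_den_dvd one_pos).1 (by simpa using hlat))

lemma exists_isDeltaPolynomial {n : ℕ} {P : Set (Fin n → ℝ)} (hP : IsRationalPolytope P)
    (h0 : 0 ∈ P) : ∃ δ, IsDeltaPolynomial P δ :=
  hasDenominator_ehrhartSeries hP.den_mem.1 hP.1 h0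
    ((isLatticePolytope_smul_iff hP.1 hP.den_mem.1).1 hP.den_mem.2)

/-! ### Free sums -/

/-- A linear map that preserves the lattice, fixes `P` pointwise and kills `Q`. Its existence is
the property of a free sum `P ⊕ Q` from which everything else follows. -/
structure IsLatticeSplitting {n : ℕ} (P Q : Set (Fin n → ℝ))
    (π : (Fin n → ℝ) →ₗ[ℝ] (Fin n → ℝ)) : Prop where
  map_left : ∀ x ∈ P, π x = x
  map_right : ∀ y ∈ Q, π y = 0
  map_lattice : ∀ z ∈ integerPoints n, π z ∈ integerPoints n

lemma coordSubspace_apply_eq_zero {n : ℕ} {A : Set (Fin n)} {x : Fin n → ℝ}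
    (hx : x ∈ coordSubspace A) {i : Fin n} (hi : i ∉ A) : x i = 0 := by
  have hle : coordSubspace A ≤
      LinearMap.ker (LinearMap.proj (R := ℝ) (φ := fun _ : Fin n => ℝ) i) := by
    refine Submodule.span_le.2 ?_
    rintro _ ⟨j, hj, rfl⟩
    have hij : i ≠ j := fun h => hi (h ▸ hj)
    simp [hij]
  exact hle hx

lemma slAct_mem_integerPoints {n : ℕ} (g : Matrix.SpecialLinearGroup (Fin n) ℤ) {x : Fin n → ℝ}
    (hx : x ∈ integerPoints n) : slAct g x ∈ integerPoints n := by
  choose z hz using hx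
  intro i
  refine ⟨∑ j, (g : Matrix (Fin n) (Fin n) ℤ) i j * z j, ?_⟩
  simp [slAct, Matrix.mulVec, dotProduct, hz]

lemma slAct_inv_slAct {n : ℕ} (g : Matrix.SpecialLinearGroup (Fin n) ℤ) (x : Fin n → ℝ) :
    slAct g⁻¹ (slAct g x) = x := by
  have h : ((g⁻¹ : Matrix.SpecialLinearGroup (Fin n) ℤ) : Matrix (Fin n) (Fin n) ℤ)
      * (g : Matrix (Fin n) (Fin n) ℤ) = 1 := by
    rw [← Matrix.SpecialLinearGroup.coe_mul, inv_mul_cancel, Matrix.SpecialLinearGroup.coe_one]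
  have h' := congrArg (fun M => M.map (Int.castRingHom ℝ)) h
  simp only [Matrix.map_mul] at h'
  rw [slAct, slAct, Matrix.mulVec_mulVec]
  have h1 : (1 : Matrix (Fin n) (Fin n) ℤ).map (Int.castRingHom ℝ) = 1 :=
    Matrix.map_one _ (map_zero _) (map_one _)
  rw [h1] at h'
  exact (congrArg (fun M => Matrix.mulVec M x) h').trans (Matrix.one_mulVec x)

lemma IsFreeSum.exists_splitting {n : ℕ} {P Q : Set (Fin n → ℝ)} (h : IsFreeSum P Q) :
    0 ∈ P ∧ 0 ∈ Q ∧ ∃ π, IsLatticeSplitting P Q π := by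
  classical
  obtain ⟨g, h0P, h0Q, A, B, hAB, hA, hB⟩ := h
  have hzero : ∀ S : Set (Fin n → ℝ), (0 : Fin n → ℝ) ∈ slAct g '' S → (0 : Fin n → ℝ) ∈ S := by
    rintro S ⟨x, hx, hx0⟩
    have h1 := slAct_inv_slAct g x
    rw [hx0, slAct, Matrix.mulVec_zero] at h1
    rwa [h1]
  -- The splitting is the coordinate projection to `A`, conjugated by `g`.
  let act : Matrix.SpecialLinearGroup (Fin n) ℤ → (Fin n → ℝ) →ₗ[ℝ] (Fin n → ℝ) := fun g =>
    Matrix.mulVecLin ((g : Matrix (Fin n) (Fin n) ℤ).map (fun z : ℤ => (z : ℝ)))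
  let proj : (Fin n → ℝ) →ₗ[ℝ] (Fin n → ℝ) :=
    LinearMap.pi fun i => if i ∈ A then LinearMap.proj i else 0
  have hproj : ∀ x i, proj x i = if i ∈ A then x i else 0 := fun x i => by
    simp only [proj, LinearMap.pi_apply]
    split_ifs <;> rfl
  refine ⟨hzero P h0P, hzero Q h0Q, (act g⁻¹).comp (proj.comp (act g)), ?_, ?_, ?_⟩
  · intro x hx
    have hmem : slAct g x ∈ coordSubspace A := hA ▸ Submodule.subset_span ⟨x, hx, rfl⟩
    have : proj (slAct g x) = slAct g x := by
      ext i
      rw [hproj]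
      split_ifs with hi
      · rfl
      · exact (coordSubspace_apply_eq_zero hmem hi).symm
    change slAct g⁻¹ (proj (slAct g x)) = x
    rw [this, slAct_inv_slAct]
  · intro y hy
    have hmem : slAct g y ∈ coordSubspace B := hB ▸ Submodule.subset_span ⟨y, hy, rfl⟩
    have : proj (slAct g y) = 0 := by
      ext i
      rw [hproj]
      split_ifs with hi
      · exact coordSubspace_apply_eq_zero hmem (Set.disjoint_left.1 hAB hi)
      · rfl
    change slAct g⁻¹ (proj (slAct g y)) = 0
    rw [this, slAct, Matrix.mulVec_zero]
  · intro z hz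
    change slAct g⁻¹ (proj (slAct g z)) ∈ _
    refine slAct_mem_integerPoints _ fun i => ?_
    rw [hproj]
    split_ifs
    · exact slAct_mem_integerPoints g hz i
    · exact ⟨0, by simp⟩

lemma mem_smul_hullSum {n : ℕ} {P Q : Set (Fin n → ℝ)} (hP : Convex ℝ P) (hQ : Convex ℝ Q)
    (hP0 : P.Nonempty) (hQ0 : Q.Nonempty) {r : ℝ} (hr : 0 ≤ r) {z : Fin n → ℝ} :
    z ∈ r • hullSum P Q ↔
      ∃ s t : ℝ, 0 ≤ s ∧ 0 ≤ t ∧ s + t = r ∧ ∃ x ∈ s • P, ∃ y ∈ t • Q, z = x + y := by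
  constructor
  · rintro ⟨w, hw, rfl⟩
    rw [hullSum, hP.convexHull_union hQ hP0 hQ0, mem_convexJoin] at hw
    obtain ⟨p, hp, q, hq, a, b, ha, hb, hab, rfl⟩ := hw
    refine ⟨r * a, r * b, mul_nonneg hr ha, mul_nonneg hr hb, by rw [← mul_add, hab, mul_one],
      _, Set.smul_mem_smul_set hp, _, Set.smul_mem_smul_set hq, ?_⟩
    simp only [smul_add, smul_smul]
  · rintro ⟨s, t, hs, ht, rfl, x, hx, y, hy, rfl⟩
    rw [hullSum, (convex_convexHull ℝ (P ∪ Q)).add_smul hs ht]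
    exact Set.add_mem_add
      (Set.smul_set_mono (Set.subset_union_left.trans (subset_convexHull ℝ _)) hx)
      (Set.smul_set_mono (Set.subset_union_right.trans (subset_convexHull ℝ _)) hy)

namespace IsLatticeSplitting

variable {n : ℕ} {P Q : Set (Fin n → ℝ)} {π : (Fin n → ℝ) →ₗ[ℝ] (Fin n → ℝ)}

lemma map_add (h : IsLatticeSplitting P Q π) {s t : ℝ} {x y : Fin n → ℝ} (hx : x ∈ s • P)
    (hy : y ∈ t • Q) : π (x + y) = x := by
  obtain ⟨p, hp, rfl⟩ := hx
  obtain ⟨q, hq, rfl⟩ := hy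
  simp [h.map_left p hp, h.map_right q hq]

lemma left_mem_integerPoints (h : IsLatticeSplitting P Q π) {s t : ℝ} {x y : Fin n → ℝ}
    (hx : x ∈ s • P) (hy : y ∈ t • Q) (hz : x + y ∈ integerPoints n) : x ∈ integerPoints n := by
  have := h.map_lattice _ hz
  rwa [h.map_add hx hy] at this

lemma right_mem_integerPoints (h : IsLatticeSplitting P Q π) {s t : ℝ} {x y : Fin n → ℝ}
    (hx : x ∈ s • P) (hy : y ∈ t • Q) (hz : x + y ∈ integerPoints n) : y ∈ integerPoints n := by
  have := (integerLattice n).sub_mem hz (h.left_mem_integerPoints hx hy hz)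
  rwa [add_sub_cancel_left] at this

lemma dim_hullSum (h : IsLatticeSplitting P Q π) (h0P : 0 ∈ P) (h0Q : 0 ∈ Q) :
    dim (hullSum P Q) = dim P + dim Q := by
  have h0 : (0 : Fin n → ℝ) ∈ hullSum P Q := subset_convexHull ℝ _ (Or.inl h0P)
  have hspan : Submodule.span ℝ (hullSum P Q) = Submodule.span ℝ P ⊔ Submodule.span ℝ Q := by
    rw [← Submodule.span_union]
    exact le_antisymm (Submodule.span_le.2 (convexHull_min Submodule.subset_span
      (Submodule.span ℝ (P ∪ Q)).convex)) (Submodule.span_mono (subset_convexHull ℝ _))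
  have hinf : Submodule.span ℝ P ⊓ Submodule.span ℝ Q = ⊥ := by
    rw [eq_bot_iff]
    rintro x ⟨hxP, hxQ⟩
    have h1 : Submodule.span ℝ P ≤ LinearMap.eqLocus π LinearMap.id :=
      Submodule.span_le.2 fun y hy => h.map_left y hy
    have h2 : Submodule.span ℝ Q ≤ LinearMap.ker π :=
      Submodule.span_le.2 fun y hy => h.map_right y hy
    have h3 : π x = x := h1 hxP
    have h4 : π x = 0 := h2 hxQ
    rw [Submodule.mem_bot, ← h3, h4]
  rw [dim_eq_finrank_span_of_zero_mem h0, dim_eq_finrank_span_of_zero_mem h0P,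
    dim_eq_finrank_span_of_zero_mem h0Q, hspan, ← Submodule.finrank_sup_add_finrank_inf_eq, hinf,
    finrank_bot, add_zero]

/-- The complementary projection splits `Q ⊕ P`. -/
lemma symm (h : IsLatticeSplitting P Q π) :
    IsLatticeSplitting Q P (LinearMap.id - π) where
  map_left y hy := by simp [h.map_right y hy]
  map_right x hx := by simp [h.map_left x hx]
  map_lattice z hz := (integerLattice n).sub_mem hz (h.map_lattice z hz)

lemma mem_extremePoints_hullSum (h : IsLatticeSplitting P Q π) (hP : Convex ℝ P)
    (hQ : Convex ℝ Q) (h0P : 0 ∈ P) (h0Q : 0 ∈ Q) {v : Fin n → ℝ} (hv : v ∈ P.extremePoints ℝ)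
    (hv0 : v ≠ 0) : v ∈ (hullSum P Q).extremePoints ℝ := by
  have hvP : v ∈ P := hv.1
  have hdecomp : ∀ z ∈ hullSum P Q, ∃ a b : ℝ, 0 ≤ a ∧ 0 ≤ b ∧ a + b = 1 ∧
      ∃ p ∈ P, ∃ q ∈ Q, z = a • p + b • q ∧ π z = a • p := by
    intro z hz
    have hz' : z ∈ (1 : ℝ) • hullSum P Q := by rwa [one_smul]
    obtain ⟨a, b, ha, hb, hab, _, ⟨p, hp, rfl⟩, _, ⟨q, hq, rfl⟩, rfl⟩ :=
      (mem_smul_hullSum hP hQ ⟨0, h0P⟩ ⟨0, h0Q⟩ zero_le_one).1 hz'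
    exact ⟨a, b, ha, hb, hab, p, hp, q, hq, rfl,
      h.map_add (Set.smul_mem_smul_set hp) (Set.smul_mem_smul_set hq)⟩
  have hproj : ∀ z ∈ hullSum P Q, π z ∈ P := fun z hz => by
    obtain ⟨a, b, ha, hb, hab, p, hp, q, hq, -, hπ⟩ := hdecomp z hz
    rw [hπ]
    exact hP.smul_mem_of_zero_mem h0P hp ⟨ha, by linarith⟩
  -- A point of the hull projecting to the nonzero vertex `v` is `v` itself.
  have hfib : ∀ z ∈ hullSum P Q, π z = v → z = v := fun z hz hzv => by
    obtain ⟨a, b, ha, hb, hab, p, hp, q, hq, rfl, hπ⟩ := hdecomp z hz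
    rw [hzv] at hπ
    have ha0 : 0 < a := ha.lt_of_ne fun h0 => hv0 (by rw [hπ, ← h0, zero_smul])
    rcases hb.eq_or_lt with hb0 | hb0
    · rw [← hb0, zero_smul, add_zero, hπ]
    · refine absurd ?_ hv0
      refine ((mem_extremePoints.1 hv).2 p hp 0 h0P ⟨a, b, ha0, hb0, hab, ?_⟩).2.symm
      rw [smul_zero, add_zero, hπ]
  refine mem_extremePoints.2 ⟨subset_convexHull ℝ _ (Or.inl hvP), fun z₁ hz₁ z₂ hz₂ hseg => ?_⟩
  obtain ⟨a, b, ha, hb, hab, he⟩ := hseg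
  have := (mem_extremePoints.1 hv).2 _ (hproj z₁ hz₁) _ (hproj z₂ hz₂)
    ⟨a, b, ha, hb, hab, by rw [← map_smul, ← map_smul, ← _root_.map_add, he, h.map_left v hvP]⟩
  exact ⟨hfib z₁ hz₁ this.1, hfib z₂ hz₂ this.2⟩

end IsLatticeSplitting

lemma IsPolytope.hullSum {n : ℕ} {P Q : Set (Fin n → ℝ)} (hP : IsPolytope P)
    (hQ : IsPolytope Q) : IsPolytope (hullSum P Q) := by
  obtain ⟨V, hV, rfl⟩ := hP
  obtain ⟨W, hW, rfl⟩ := hQ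
  refine ⟨V ∪ W, hV.union hW, ?_⟩
  rw [FreeSumEhrhart.hullSum, convexHull_convexHull_union_left, convexHull_convexHull_union_right]

lemma extremePoints_hullSum_subset {n : ℕ} {P Q : Set (Fin n → ℝ)} (hP : IsPolytope P)
    (hQ : IsPolytope Q) :
    (hullSum P Q).extremePoints ℝ ⊆ P.extremePoints ℝ ∪ Q.extremePoints ℝ := by
  have : hullSum P Q = convexHull ℝ (P.extremePoints ℝ ∪ Q.extremePoints ℝ) := by
    rw [← convexHull_convexHull_union_left, ← convexHull_convexHull_union_right,
      hP.convexHull_extremePoints, hQ.convexHull_extremePoints, hullSum]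
  rw [this]
  exact extremePoints_convexHull_subset

lemma IsRationalPolytope.hullSum {n : ℕ} {P Q : Set (Fin n → ℝ)} (hP : IsRationalPolytope P)
    (hQ : IsRationalPolytope Q) : IsRationalPolytope (hullSum P Q) :=
  ⟨hP.1.hullSum hQ.1,
    (extremePoints_hullSum_subset hP.1 hQ.1).trans (Set.union_subset hP.2 hQ.2)⟩

lemma IsLatticeSplitting.den_hullSum {n : ℕ} {P Q : Set (Fin n → ℝ)}
    {π : (Fin n → ℝ) →ₗ[ℝ] (Fin n → ℝ)} (h : IsLatticeSplitting P Q π)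
    (hP : IsRationalPolytope P) (hQ : IsRationalPolytope Q) (h0P : 0 ∈ P) (h0Q : 0 ∈ Q) :
    den (hullSum P Q) = Nat.lcm (den P) (den Q) := by
  have hPQ := hP.hullSum hQ
  have key : ∀ m, 0 < m → (den (hullSum P Q) ∣ m ↔ den P ∣ m ∧ den Q ∣ m) := by
    intro m hm
    rw [← hP.isLatticePolytope_smul_iff_den_dvd hm, ← hQ.isLatticePolytope_smul_iff_den_dvd hm,
      ← hPQ.isLatticePolytope_smul_iff_den_dvd hm, isLatticePolytope_smul_iff hP.1 hm,
      isLatticePolytope_smul_iff hQ.1 hm, isLatticePolytope_smul_iff hPQ.1 hm]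
    have hz : (m : ℝ) • (0 : Fin n → ℝ) ∈ integerPoints n := by
      rw [smul_zero]
      exact (integerLattice n).zero_mem
    constructor
    · refine fun hm' => ⟨fun v hv => ?_, fun v hv => ?_⟩ <;> rcases eq_or_ne v 0 with rfl | hv0
      · exact hz
      · exact hm' v (h.mem_extremePoints_hullSum hP.1.convex hQ.1.convex h0P h0Q hv hv0)
      · exact hz
      · refine hm' v ?_
        have := h.symm.mem_extremePoints_hullSum hQ.1.convex hP.1.convex h0Q h0P hv hv0
        rwa [FreeSumEhrhart.hullSum, Set.union_comm] at this
    · rintro ⟨h1, h2⟩ v hv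
      exact (extremePoints_hullSum_subset hP.1 hQ.1 hv).elim (h1 v) (h2 v)
  have hlcm : 0 < Nat.lcm (den P) (den Q) := Nat.lcm_pos hP.den_mem.1 hQ.den_mem.1
  refine Nat.dvd_antisymm ((key _ hlcm).2 ⟨Nat.dvd_lcm_left _ _, Nat.dvd_lcm_right _ _⟩) ?_
  obtain ⟨h1, h2⟩ := (key _ hPQ.den_mem.1).1 dvd_rfl
  exact Nat.lcm_dvd h1 h2

/-! ### The Ehrhart series of a free sum -/

/-- The lattice points of `iP` that lie in no smaller integral dilate. -/
def latticeShell {n : ℕ} (P : Set (Fin n → ℝ)) (i : ℕ) : Set (Fin n → ℝ) :=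
  {x | x ∈ ((i : ℝ) • P) ∩ integerPoints n ∧ ∀ j < i, x ∉ (j : ℝ) • P}

lemma coeff_one_sub_X_mul_ehrhartSeries {n : ℕ} {P : Set (Fin n → ℝ)} (hP : IsPolytope P)
    (h0 : 0 ∈ P) (i : ℕ) : PowerSeries.coeff i ((1 - PowerSeries.X) * ehrhartSeries P)
      = ((latticeShell P i).ncard : ℚ) := by
  obtain ⟨R, hR⟩ := hP.exists_ncard_le h0
  rw [sub_mul, one_mul, map_sub, ehrhartSeries_coeff h0]
  cases i with
  | zero =>
    rw [PowerSeries.coeff_zero_X_mul, sub_zero]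
    simp [latticeShell]
  | succ i =>
    rw [PowerSeries.coeff_succ_X_mul, ehrhartSeries_coeff h0]
    have hsub : ∀ j ≤ i, (j : ℝ) • P ⊆ (i : ℝ) • P := fun j hj =>
      smul_set_mono_of_zero_mem hP.convex h0 (Nat.cast_nonneg j) (Nat.cast_le.2 hj)
    have hunion : (((i + 1 : ℕ) : ℝ) • P) ∩ integerPoints n
        = latticeShell P (i + 1) ∪ ((i : ℝ) • P) ∩ integerPoints n := by
      ext x
      constructor
      · intro hx
        by_cases hxi : x ∈ (i : ℝ) • P
        · exact Or.inr ⟨hxi, hx.2⟩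
        · exact Or.inl ⟨hx, fun j hj hxj => hxi (hsub j (Nat.lt_succ_iff.1 hj) hxj)⟩
      · rintro (hx | hx)
        · exact hx.1
        · exact ⟨smul_set_mono_of_zero_mem hP.convex h0 (Nat.cast_nonneg i)
            (Nat.cast_le.2 i.le_succ) hx.1, hx.2⟩
    rw [hunion, Set.ncard_union_eq _ ((hR (i + 1)).1.subset fun x hx => hx.1) (hR i).1]
    · push_cast
      ring
    · exact Set.disjoint_left.2 fun x hx hx' => hx.2 i i.lt_succ_self hx'.1

/-- Every lattice point `z` of `k(P ⊕ Q)` is uniquely `x + y` with `x` in the shell of `P` of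
some height `i ≤ k` and `y ∈ (k - i)Q`: the gauge of `P` at `x` is the integer `i`, so the rest
of the dilation is available for `y`. -/
lemma ehrhartSeries_hullSum {n : ℕ} {P Q : Set (Fin n → ℝ)}
    {π : (Fin n → ℝ) →ₗ[ℝ] (Fin n → ℝ)} (h : IsLatticeSplitting P Q π) (hP : IsPolytope P)
    (hQ : IsPolytope Q) (hdual : DualIsLatticePolyhedron P) (h0P : 0 ∈ P) (h0Q : 0 ∈ Q) :
    ehrhartSeries (hullSum P Q) = (1 - PowerSeries.X) * ehrhartSeries P * ehrhartSeries Q := by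
  classical
  have h0 : (0 : Fin n → ℝ) ∈ hullSum P Q := subset_convexHull ℝ _ (Or.inl h0P)
  obtain ⟨RP, hRP⟩ := hP.exists_ncard_le h0P
  obtain ⟨RQ, hRQ⟩ := hQ.exists_ncard_le h0Q
  obtain ⟨R, hR⟩ := (hP.hullSum hQ).exists_ncard_le h0
  have hfS : ∀ i, (latticeShell P i).Finite := fun i => (hRP i).1.subset fun x hx => hx.1
  ext k
  rw [PowerSeries.coeff_mul, ehrhartSeries_coeff h0]
  simp only [coeff_one_sub_X_mul_ehrhartSeries hP h0P, ehrhartSeries_coeff h0Q]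
  rw [Set.ncard_eq_toFinset_card _ (hR k).1]
  simp only [Set.ncard_eq_toFinset_card _ (hfS _), Set.ncard_eq_toFinset_card _ (hRQ _).1,
    ← Nat.cast_mul, ← Finset.card_product]
  rw [← Nat.cast_sum, ← Finset.card_sigma]
  congr 1
  symm
  refine Finset.card_bij (fun a _ => a.2.1 + a.2.2) ?_ ?_ ?_
  · rintro ⟨⟨i, j⟩, x, y⟩ ha
    simp only [Finset.mem_sigma, Finset.mem_product,
      Set.Finite.mem_toFinset] at ha ⊢
    obtain ⟨hij, hx, hy⟩ := ha
    have hij := Finset.HasAntidiagonal.mem_antidiagonal.1 hij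
    refine ⟨?_, (integerLattice n).add_mem hx.1.2 hy.2⟩
    exact (mem_smul_hullSum hP.convex hQ.convex ⟨0, h0P⟩ ⟨0, h0Q⟩ (Nat.cast_nonneg k)).2
      ⟨i, j, Nat.cast_nonneg i, Nat.cast_nonneg j, by exact_mod_cast hij, x, hx.1.1, y, hy.1, rfl⟩
  · rintro ⟨⟨i, j⟩, x, y⟩ ha ⟨⟨i', j'⟩, x', y'⟩ ha' he
    simp only [Finset.mem_sigma, Finset.mem_product,
      Set.Finite.mem_toFinset] at ha ha' he
    obtain ⟨hij, hx, hy⟩ := ha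
    have hij := Finset.HasAntidiagonal.mem_antidiagonal.1 hij
    obtain ⟨hij', hx', hy'⟩ := ha'
    have hij' := Finset.HasAntidiagonal.mem_antidiagonal.1 hij'
    have hxx : x = x' := by rw [← h.map_add hx.1.1 hy.1, he, h.map_add hx'.1.1 hy'.1]
    subst hxx
    have hyy : y = y' := add_left_cancel he
    subst hyy
    have hii : i = i' := le_antisymm (not_lt.1 fun hlt => hx.2 i' hlt hx'.1.1)
      (not_lt.1 fun hlt => hx'.2 i hlt hx.1.1)
    subst hii
    have hjj : j = j' := by omega
    subst hjj
    rfl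
  · intro z hz
    rw [Set.Finite.mem_toFinset] at hz
    obtain ⟨s, t, hs, ht, hst, x, hx, y, hy, rfl⟩ :=
      (mem_smul_hullSum hP.convex hQ.convex ⟨0, h0P⟩ ⟨0, h0Q⟩ (Nat.cast_nonneg k)).1 hz.1
    have hxZ := h.left_mem_integerPoints hx hy hz.2
    have hyZ := h.right_mem_integerPoints hx hy hz.2
    have hxfl := mem_floor_smul_of_dualIsLatticePolyhedron hP h0P hdual hs hx hxZ
    have hex : ∃ i : ℕ, x ∈ (i : ℝ) • P := ⟨_, hxfl⟩
    have hi : ((Nat.find hex : ℕ) : ℝ) ≤ s :=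
      (Nat.cast_le.2 (Nat.find_min' hex hxfl)).trans (Nat.floor_le hs)
    have hik : Nat.find hex ≤ k := by
      have : ((Nat.find hex : ℕ) : ℝ) ≤ k := by linarith
      exact_mod_cast this
    refine ⟨⟨(Nat.find hex, k - Nat.find hex), x, y⟩, ?_, rfl⟩
    simp only [Finset.mem_sigma, Finset.mem_product,
      Set.Finite.mem_toFinset]
    refine ⟨Finset.HasAntidiagonal.mem_antidiagonal.2 (Nat.add_sub_cancel' hik),
      ⟨⟨Nat.find_spec hex, hxZ⟩, fun j hj => Nat.find_min hex hj⟩, ?_, hyZ⟩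
    refine smul_set_mono_of_zero_mem hQ.convex h0Q ht ?_ hy
    rw [Nat.cast_sub hik]
    linarith

end FreeSumEhrhart

end

open FreeSumEhrhart in
theorem mainTheorem6 (n : ℕ) (P Q : Set (Fin n → ℝ))
    (hP : IsRationalPolytope P) (hQ : IsRationalPolytope Q)
    (hdual : DualIsLatticePolyhedron P) (hfree : IsFreeSum P Q) :
    ehrhartSeries (hullSum P Q)
        = (1 - PowerSeries.X) * ehrhartSeries P * ehrhartSeries Q ∧
    ∃ δP δQ δPQ : Polynomial ℚ,
      IsDeltaPolynomial P δP ∧ IsDeltaPolynomial Q δQ ∧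
      IsDeltaPolynomial (hullSum P Q) δPQ ∧
      algebraMap (Polynomial ℚ) (RatFunc ℚ) δPQ
        = (1 - RatFunc.X) *
              (1 - RatFunc.X ^ Nat.lcm (den P) (den Q)) ^ (dim P + dim Q + 1) /
            ((1 - RatFunc.X ^ den P) ^ (dim P + 1) * (1 - RatFunc.X ^ den Q) ^ (dim Q + 1)) *
          algebraMap (Polynomial ℚ) (RatFunc ℚ) δP *
          algebraMap (Polynomial ℚ) (RatFunc ℚ) δQ ∧
      (IsLatticePolytope P → IsLatticePolytope Q → δPQ = δP * δQ) := by
  obtain ⟨h0P, h0Q, π, hπ⟩ := hfree.exists_splitting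
  have hmain := ehrhartSeries_hullSum hπ hP.1 hQ.1 hdual h0P h0Q
  refine ⟨hmain, ?_⟩
  obtain ⟨δP, hδP⟩ := exists_isDeltaPolynomial hP h0P
  obtain ⟨δQ, hδQ⟩ := exists_isDeltaPolynomial hQ h0Q
  obtain ⟨δPQ, hδPQ⟩ := exists_isDeltaPolynomial (hP.hullSum hQ)
    (subset_convexHull ℝ _ (Or.inl h0P) : (0 : Fin n → ℝ) ∈ hullSum P Q)
  have hne : ∀ d : ℕ, 0 < d → (1 - Polynomial.X ^ d : Polynomial ℚ) ≠ 0 := fun d hd h => by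
    have := congrArg (Polynomial.eval 0) h
    simp [hd.ne'] at this
  -- The asserted identity, with the denominators multiplied out.
  have hpoly : (1 - Polynomial.X ^ den P) ^ (dim P + 1) * (1 - Polynomial.X ^ den Q) ^ (dim Q + 1)
      * δPQ = (1 - Polynomial.X) *
        (1 - Polynomial.X ^ Nat.lcm (den P) (den Q)) ^ (dim P + dim Q + 1) * δP * δQ := by
    apply Polynomial.coe_injective ℚ
    have hPQ := hδPQ
    rw [IsDeltaPolynomial, hπ.den_hullSum hP hQ h0P h0Q, hπ.dim_hullSum h0P h0Q, hmain] at hPQ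
    push_cast
    rw [← hPQ, ← hδP, ← hδQ]
    ring
  refine ⟨δP, δQ, δPQ, hδP, hδQ, hδPQ, ?_, fun hPl hQl => ?_⟩
  · have hrat := congrArg (algebraMap (Polynomial ℚ) (RatFunc ℚ)) hpoly
    simp only [map_mul, map_pow, map_sub, map_one, RatFunc.algebraMap_X] at hrat
    have hneR : ∀ d : ℕ, 0 < d → (1 - RatFunc.X ^ d : RatFunc ℚ) ≠ 0 := fun d hd h => by
      refine hne d hd (RatFunc.algebraMap_injective ℚ ?_)
      simpa using h
    have h1 := pow_ne_zero (dim P + 1) (hneR _ hP.den_mem.1)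
    have h2 := pow_ne_zero (dim Q + 1) (hneR _ hQ.den_mem.1)
    rw [div_mul_eq_mul_div, div_mul_eq_mul_div, eq_div_iff (mul_ne_zero h1 h2), ← hrat]
    ring
  · rw [hPl.den_eq_one hP, hQl.den_eq_one hQ, Nat.lcm_self, pow_one] at hpoly
    have h1 : (1 - Polynomial.X : Polynomial ℚ) ^ (dim P + dim Q + 2) ≠ 0 :=
      pow_ne_zero _ (by simpa using hne 1 one_pos)
    refine mul_left_cancel₀ h1 ?_
    linear_combination hpoly
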